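/- Let $F$ be a differentially closed field of characteristic $0$ with two commuting derivations $d_x,d_y$, let $C\subset F$ be its field of constants, and let $D=F[d_x,d_y]$ be the ring of linear partial differential operators over $F$. Fix $k\ge 1$, elements $f_1,\dots,f_k\in F$ and rationals $1>s_2>\dots>s_k>0$, let $q$ be the least common denominator of $s_2,\dots,s_k$ (with $q=1$ if $k=1$), and let $G=G_{(s_2,\dots,s_k)}(f_1,\dots,f_k)$ be the symbol whose formal fractional derivatives $G^{(s)}$ ($s\in\mathbb Q$) obey $$dG^{(s)}=(df_1)G^{(1+s)}+(df_2)G^{(s_2+s)}+\dots+(df_k)G^{(s_k+s)},\qquad d=d_x,d_y.$$ Let $V_G$ be the left $D$-module of all fractional-derivatives series $\sum_{i\ge 0}h_iG^{(s_0-i/q)}$ with $h_i\in F$ and $s_0q\in\mathbb Z$ (the series $0$ included). For a left ideal $J\subset D$ put $V_G(J)=\{v\in V_G:\ pv=0 \text{ for all } p\in J\}$. Call a left ideal $J\subset D$ non-holonomic if its Hilbert–Kolchin polynomial, that is, the polynomial which agrees with $z\mapsto \dim_F\big(D_{\le z}/(J\cap D_{\le z})\big)$ for all large integers $z$, where $D_{\le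 z}$ is the space of operators of order at most $z$, has degree $1$. Let $J\subset J_1\subset D$ be non-holonomic left ideals, and let $p_1,\dots,p_t$ generate the left ideal $J_1$. Put $$\mathrm{Syz}(J,J_1)=\Big\{(q_1,\dots,q_t)\in D^t:\ \sum_{i=1}^t q_ip_i\in J\Big\},$$ $$V_G(\mathrm{Syz}(J,J_1))=\Big\{(w_1,\dots,w_t)\in V_G^t:\ \sum_{i=1}^t q_iw_i=0\ \text{ for all } (q_1,\dots,q_t)\in \mathrm{Syz}(J,J_1)\Big\}.$$ Then $V_G(J_1)\subset V_G(J)$, and the map $v\mapsto(p_1v,\dots,p_tv)$ induces an isomorphism of $C$-vector spaces $$V_G(J)/V_G(J_1)\;\cong\;V_G(\mathrm{Syz}(J,J_1)).$$ -/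

import Mathlib

universe u

namespace FDSeries

/-! ### Differential fields with two commuting derivations -/

/-- Two commuting derivations `d_x`, `d_y` on a field. -/
class PartialDiffField (F : Type*) [Field F] where
  dx : Derivation ℤ F F
  dy : Derivation ℤ F F
  dx_dy_comm : ∀ a : F, dx (dy a) = dy (dx a)

open PartialDiffField

/-- The field `C ⊆ F` of constants. -/
def constants (F : Type*) [Field F] [PartialDiffField F] : Subfield F where
  carrier := {a | dx a = 0 ∧ dy a = 0}
  mul_mem' := by
    rintro a b ⟨ha, ha'⟩ ⟨hb, hb'⟩
    simp [Derivation.leibniz, ha, ha', hb, hb']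
  one_mem' := by simp
  add_mem' := by
    rintro a b ⟨ha, ha'⟩ ⟨hb, hb'⟩
    simp [ha, ha', hb, hb']
  zero_mem' := by simp
  neg_mem' := by
    rintro a ⟨ha, ha'⟩
    simp [ha, ha']
  inv_mem' := by
    rintro a ⟨ha, ha'⟩
    simp [Derivation.leibniz_inv, ha, ha']

/-- The value, at a tuple `a` of elements of `E`, of a differential polynomial in `n` differential
indeterminates with coefficients in `F`. The variable `(k, i, j)` stands for `d_x^i d_y^j u_k`, and
the coefficients are mapped to `E` by `φ`. -/
noncomputable def evalDiffPoly {F E : Type*} [Field F] [Field E] [PartialDiffField E]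
    (φ : F →+* E) {n : ℕ} (a : Fin n → E) (P : MvPolynomial (Fin n × ℕ × ℕ) F) : E :=
  P.eval₂ φ fun v => dx^[v.2.1] (dy^[v.2.2] (a v.1))

/-- `F` is differentially closed (existentially closed among differential fields): every finite
system of differential polynomial equations and an inequation over `F` that has a solution in some
differential field extension `E` of `F` has a solution in `F`. -/
def IsDifferentiallyClosed (F : Type u) [Field F] [PartialDiffField F] : Prop :=
  ∀ (E : Type u) [Field E] [PartialDiffField E] (φ : F →+* E),
    (∀ a, φ (dx a) = dx (φ a)) → (∀ a, φ (dy a) = dy (φ a)) →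
    ∀ (n : ℕ) (S : Finset (MvPolynomial (Fin n × ℕ × ℕ) F)) (Q : MvPolynomial (Fin n × ℕ × ℕ) F),
      (∃ a : Fin n → E, (∀ P ∈ S, evalDiffPoly φ a P = 0) ∧ evalDiffPoly φ a Q ≠ 0) →
      ∃ a : Fin n → F, (∀ P ∈ S, evalDiffPoly (RingHom.id F) a P = 0) ∧
        evalDiffPoly (RingHom.id F) a Q ≠ 0

/-! ### The ring `F[d_x, d_y]` of linear partial differential operators -/

/-- Linear partial differential operators `∑ a_{ij} d_x^i d_y^j` with coefficients in `F`
(coefficients written on the left), as formal expressions. -/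
def DiffOp (F : Type*) [Field F] : Type _ := ℕ × ℕ →₀ F

/-- An `F`-vector space with commuting actions of `d_x` and `d_y` obeying the Leibniz rule. -/
class DiffModule (F : Type*) [Field F] [PartialDiffField F] (M : Type*) [AddCommGroup M]
    [Module F M] where
  δx : AddMonoid.End M
  δy : AddMonoid.End M
  leibniz_x : ∀ (a : F) (m : M), δx (a • m) = dx a • m + a • δx m
  leibniz_y : ∀ (a : F) (m : M), δy (a • m) = dy a • m + a • δy m
  comm : ∀ m : M, δx (δy m) = δy (δx m)

namespace DiffOp

noncomputable instance (F : Type*) [Field F] : AddCommGroup (DiffOp F) :=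
  inferInstanceAs (AddCommGroup (ℕ × ℕ →₀ F))

noncomputable instance (F : Type*) [Field F] : Module F (DiffOp F) :=
  inferInstanceAs (Module F (ℕ × ℕ →₀ F))

/-- The operator `a d_x^i d_y^j`. -/
noncomputable def monomial {F : Type*} [Field F] (i j : ℕ) : F →ₗ[F] DiffOp F :=
  Finsupp.lsingle (M := F) (R := F) (i, j)

/-- The coefficient of `d_x^i d_y^j`. -/
def coeff {F : Type*} [Field F] (p : DiffOp F) (i j : ℕ) : F :=
  (show ℕ × ℕ →₀ F from p) (i, j)

theorem induction_on {F : Type*} [Field F] {P : DiffOp F → Prop} (p : DiffOp F)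
    (h0 : P 0) (hadd : ∀ p q, P p → P q → P (p + q))
    (hmon : ∀ i j a, P (monomial i j a)) : P p :=
  Finsupp.induction_linear (motive := P) p h0 hadd (fun ij a => hmon ij.1 ij.2 a)

/-- Additive maps out of the operators agree if they agree on the `a d_x^i d_y^j`. -/
theorem hom_ext {F : Type*} [Field F] {N : Type*} [AddCommGroup N] {f g : DiffOp F →+ N}
    (h : ∀ i j a, f (monomial i j a) = g (monomial i j a)) : f = g := by
  ext p
  induction p using induction_on with
  | h0 => simp
  | hadd p q hp hq => simp [hp, hq]
  | hmon i j a => exact h i j a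

/-- Left multiplication by a first order symbol: `a d_x^i d_y^j ↦ (d a) d_x^i d_y^j +
a d_x^{i+k} d_y^{j+l}`, where `d` is the derivation with symbol `d_x^k d_y^l`. -/
noncomputable def leftMul {F : Type*} [Field F] (d : Derivation ℤ F F) (k l : ℕ) :
    DiffOp F →+ DiffOp F :=
  Finsupp.liftAddHom (M := F) fun ij : ℕ × ℕ =>
    (monomial ij.1 ij.2).toAddMonoidHom.comp d.toLinearMap.toAddMonoidHom +
      (monomial (ij.1 + k) (ij.2 + l)).toAddMonoidHom

theorem leftMul_monomial {F : Type*} [Field F] (d : Derivation ℤ F F) (k l i j : ℕ) (a : F) :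
    leftMul d k l (monomial i j a) = monomial i j (d a) + monomial (i + k) (j + l) a :=
  Finsupp.liftAddHom_apply_single (M := F) _ _ _

theorem smul_monomial {F : Type*} [Field F] (a b : F) (i j : ℕ) :
    a • monomial i j b = monomial i j (a * b) := by
  rw [← LinearMap.map_smul, smul_eq_mul]

theorem leftMul_smul {F : Type*} [Field F] (d : Derivation ℤ F F) (k l : ℕ) (a : F)
    (p : DiffOp F) : leftMul d k l (a • p) = d a • p + a • leftMul d k l p := by
  induction p using induction_on with
  | h0 => simp
  | hadd p q hp hq => simp only [smul_add, map_add, hp, hq]; abel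
  | hmon i j b =>
    simp only [smul_monomial, leftMul_monomial, smul_add, Derivation.leibniz, smul_eq_mul, map_add]
    rw [mul_comm b (d a)]
    abel

/-- The operators themselves, with `d_x` and `d_y` acting by multiplication on the left.
Not an instance, to avoid a second module structure of the ring over itself. -/
noncomputable abbrev selfModule (F : Type*) [Field F] [PartialDiffField F] :
    DiffModule F (DiffOp F) where
  δx := leftMul dx 1 0
  δy := leftMul dy 0 1
  leibniz_x := leftMul_smul _ _ _
  leibniz_y := leftMul_smul _ _ _
  comm p := by
    change leftMul dx 1 0 (leftMul dy 0 1 p) = leftMul dy 0 1 (leftMul dx 1 0 p)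
    induction p using induction_on with
    | h0 => simp
    | hadd p q hp hq => simp only [map_add, hp, hq]
    | hmon i j a =>
      simp only [leftMul_monomial, map_add, dx_dy_comm, add_zero]
      abel

section act

variable {F : Type*} [Field F] [PartialDiffField F] {M : Type*} [AddCommGroup M] [Module F M]

theorem end_mul_apply (f g : AddMonoid.End M) (m : M) : (f * g) m = f (g m) := rfl

/-- The action `(∑ a_{ij} d_x^i d_y^j) m = ∑ a_{ij} d_x^i (d_y^j m)`. -/
noncomputable def act (S : DiffModule F M) : DiffOp F →+ M →+ M :=
  Finsupp.liftAddHom (M := F) fun ij : ℕ × ℕ =>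
    { toFun := fun a =>
        (DistribSMul.toAddMonoidHom M a).comp (S.δx ^ ij.1 * S.δy ^ ij.2 : AddMonoid.End M)
      map_zero' := by ext m; exact zero_smul F _
      map_add' := fun a b => by ext m; exact add_smul a b _ }

theorem act_monomial (S : DiffModule F M) (i j : ℕ) (a : F) (m : M) :
    act S (monomial i j a) m =
      a • ((S.δx ^ i * S.δy ^ j : AddMonoid.End M) m) :=
  DFunLike.congr_fun (Finsupp.liftAddHom_apply_single (M := F) _ _ _) m

theorem act_smul (S : DiffModule F M) (a : F) (p : DiffOp F) (m : M) :
    act S (a • p) m = a • act S p m := by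
  induction p using induction_on with
  | h0 => simp
  | hadd p q hp hq => simp [hp, hq]
  | hmon i j b => rw [smul_monomial, act_monomial, act_monomial, mul_smul]

theorem act_δx (S : DiffModule F M) (p : DiffOp F) (m : M) :
    act S ((selfModule F).δx p) m = S.δx (act S p m) := by
  induction p using induction_on with
  | h0 => simp
  | hadd p q hp hq => simp only [map_add, AddMonoidHom.add_apply, hp, hq]
  | hmon i j b =>
    change act S (leftMul dx 1 0 (monomial i j b)) m = _
    rw [leftMul_monomial, map_add, AddMonoidHom.add_apply, act_monomial, act_monomial, act_monomial,
      S.leibniz_x, add_zero, pow_succ', mul_assoc]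
    rfl

theorem act_δy (S : DiffModule F M) (p : DiffOp F) (m : M) :
    act S ((selfModule F).δy p) m = S.δy (act S p m) := by
  have hc : Commute (S.δx : AddMonoid.End M) S.δy := AddMonoidHom.ext S.comm
  induction p using induction_on with
  | h0 => simp
  | hadd p q hp hq => simp only [map_add, AddMonoidHom.add_apply, hp, hq]
  | hmon i j b =>
    change act S (leftMul dy 0 1 (monomial i j b)) m = _
    rw [leftMul_monomial, map_add, AddMonoidHom.add_apply, act_monomial, act_monomial, act_monomial,
      S.leibniz_y, add_zero, pow_succ', ← mul_assoc, (hc.pow_left i).eq, mul_assoc]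
    rfl

theorem act_act (S : DiffModule F M) (p q : DiffOp F) (m : M) :
    act S (act (selfModule F) p q) m = act S p (act S q m) := by
  have hx : ∀ (i : ℕ) (q : DiffOp F),
      act S (((selfModule F).δx ^ i : AddMonoid.End (DiffOp F)) q) m =
        (S.δx ^ i : AddMonoid.End M) (act S q m) := by
    intro i
    induction i with
    | zero => intro q; simp
    | succ i ih =>
      intro q
      rw [pow_succ, pow_succ]
      exact (ih _).trans (congrArg _ (act_δx S q m))
  have hy : ∀ (i : ℕ) (q : DiffOp F),
      act S (((selfModule F).δy ^ i : AddMonoid.End (DiffOp F)) q) m =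
        (S.δy ^ i : AddMonoid.End M) (act S q m) := by
    intro i
    induction i with
    | zero => intro q; simp
    | succ i ih =>
      intro q
      rw [pow_succ, pow_succ]
      exact (ih _).trans (congrArg _ (act_δy S q m))
  induction p using induction_on with
  | h0 => simp
  | hadd p p' hp hp' => simp only [map_add, AddMonoidHom.add_apply, hp, hp']
  | hmon i j b =>
    rw [act_monomial, act_monomial, act_smul]
    congr 1
    exact (hx _ _).trans (congrArg _ (hy _ _))

theorem one_act (S : DiffModule F M) (m : M) : act S (monomial 0 0 1) m = m := by
  rw [act_monomial, one_smul, pow_zero, pow_zero, one_mul]; rfl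

theorem act_one (p : DiffOp F) : act (selfModule F) p (monomial 0 0 1) = p := by
  have hy : ∀ j : ℕ, ((selfModule F).δy ^ j : AddMonoid.End (DiffOp F)) (monomial 0 0 1) =
      monomial 0 j 1 := by
    intro j
    induction j with
    | zero => simp
    | succ j ih =>
      rw [pow_succ', end_mul_apply, ih]
      exact (leftMul_monomial _ _ _ _ _ _).trans (by simp)
  have hx : ∀ i j : ℕ, ((selfModule F).δx ^ i : AddMonoid.End (DiffOp F)) (monomial 0 j 1) =
      monomial i j 1 := by
    intro i j
    induction i with
    | zero => simp
    | succ i ih =>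
      rw [pow_succ', end_mul_apply, ih]
      exact (leftMul_monomial _ _ _ _ _ _).trans (by simp)
  induction p using induction_on with
  | h0 => simp
  | hadd p q hp hq => simp only [map_add, AddMonoidHom.add_apply, hp, hq]
  | hmon i j b => rw [act_monomial, end_mul_apply, hy, hx, smul_monomial, mul_one]

/-- Constants commute with the action of operators. -/
theorem act_constants_smul (S : DiffModule F M) (c : constants F) (p : DiffOp F) (m : M) :
    act S p (c • m) = c • act S p m := by
  obtain ⟨c, hcx, hcy⟩ := c
  change act S p (c • m) = c • act S p m
  have hx : ∀ (i : ℕ) (m : M), (S.δx ^ i : AddMonoid.End M) (c • m) =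
      c • (S.δx ^ i : AddMonoid.End M) m := by
    intro i
    induction i with
    | zero => intro m; simp
    | succ i ih =>
      intro m
      rw [pow_succ, end_mul_apply, end_mul_apply, S.leibniz_x, hcx, zero_smul,
        zero_add, ih]
  have hy : ∀ (i : ℕ) (m : M), (S.δy ^ i : AddMonoid.End M) (c • m) =
      c • (S.δy ^ i : AddMonoid.End M) m := by
    intro i
    induction i with
    | zero => intro m; simp
    | succ i ih =>
      intro m
      rw [pow_succ, end_mul_apply, end_mul_apply, S.leibniz_y, hcy, zero_smul,
        zero_add, ih]
  induction p using induction_on with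
  | h0 => simp
  | hadd p q hp hq => simp only [map_add, AddMonoidHom.add_apply, hp, hq, smul_add]
  | hmon i j b =>
    rw [act_monomial, act_monomial, end_mul_apply, end_mul_apply, hy, hx,
      smul_comm]

end act

/-- The ring `F[d_x, d_y]`, in which `d a = a d + d(a)` for `a ∈ F` and `d = d_x, d_y`, and
`d_x d_y = d_y d_x`. -/
noncomputable instance (F : Type*) [Field F] [PartialDiffField F] : Ring (DiffOp F) :=
  { (inferInstance : AddCommGroup (DiffOp F)) with
    mul := fun p q => act (selfModule F) p q
    one := monomial 0 0 1
    left_distrib := fun p q r => map_add (act (selfModule F) p) q r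
    right_distrib := fun p q r => DFunLike.congr_fun (map_add (act (selfModule F)) p q) r
    zero_mul := fun p => DFunLike.congr_fun (map_zero (act (selfModule F))) p
    mul_zero := fun p => map_zero (act (selfModule F) p)
    mul_assoc := fun p q r => act_act (selfModule F) p q r
    one_mul := fun p => one_act (selfModule F) p
    mul_one := fun p => act_one p }

instance (F : Type*) [Field F] [PartialDiffField F] : IsScalarTower F (DiffOp F) (DiffOp F) where
  smul_assoc a p q := act_smul (selfModule F) a p q

/-- The left `F[d_x, d_y]`-module given by commuting actions of `d_x` and `d_y`. -/
noncomputable instance {F : Type*} [Field F] [PartialDiffField F] {M : Type*} [AddCommGroup M]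
    [Module F M] [S : DiffModule F M] : Module (DiffOp F) M where
  smul p m := act S p m
  one_smul := one_act S
  mul_smul p q m := act_act S p q m
  smul_zero p := map_zero (act S p)
  smul_add p := map_add (act S p)
  add_smul p q m := DFunLike.congr_fun (map_add (act S) p q) m
  zero_smul m := DFunLike.congr_fun (map_zero (act S)) m

theorem smul_constants_smul {F : Type*} [Field F] [PartialDiffField F] {M : Type*}
    [AddCommGroup M] [Module F M] [S : DiffModule F M] (c : constants F) (p : DiffOp F) (m : M) :
    p • (c • m) = c • (p • m) :=
  act_constants_smul S c p m

/-- The `F`-space of operators of order at most `z`. -/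
def orderLE (F : Type*) [Field F] (z : ℕ) : Submodule F (DiffOp F) where
  carrier := {p | ∀ i j, z < i + j → p.coeff i j = 0}
  add_mem' := by
    intro p q hp hq i j h
    have h1 := hp i j h
    have h2 := hq i j h
    change p.coeff i j + q.coeff i j = 0
    rw [h1, h2, add_zero]
  zero_mem' := fun _ _ _ => rfl
  smul_mem' := by
    intro a p hp i j h
    change a * p.coeff i j = 0
    rw [hp i j h, mul_zero]

end DiffOp

/-! ### Non-holonomic left ideals -/

section ideals

variable {F : Type*} [Field F] [PartialDiffField F]

/-- The Hilbert-Kolchin function `z ↦ dim_F (D_{≤ z} / (J ∩ D_{≤ z}))` of a left ideal `J` of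
`D = F[d_x, d_y]`, where `D_{≤ z}` is the space of operators of order at most `z`. -/
noncomputable def hilbertKolchin (J : Ideal (DiffOp F)) (z : ℕ) : ℕ :=
  Module.finrank F
    (DiffOp.orderLE F z ⧸ (J.restrictScalars F).submoduleOf (DiffOp.orderLE F z))

/-- A left ideal is non-holonomic (of differential type 1) if its Hilbert-Kolchin polynomial, which
agrees with the Hilbert-Kolchin function for all large arguments, has degree 1. -/
def IsNonHolonomic (J : Ideal (DiffOp F)) : Prop :=
  ∃ K : Polynomial ℚ, (∀ᶠ z : ℕ in Filter.atTop, (hilbertKolchin J z : ℚ) = K.eval (z : ℚ)) ∧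
    K.degree = 1

/-- The left module `{(q_1, …, q_t) : ∑ q_i p_i ∈ J}` of relative syzygies of `J` and of the left
ideal generated by `p_1, …, p_t`. -/
noncomputable def relSyz (J : Ideal (DiffOp F)) {t : ℕ} (p : Fin t → DiffOp F) :
    Submodule (DiffOp F) (Fin t → DiffOp F) where
  carrier := {q | ∑ i, q i * p i ∈ J}
  add_mem' := by
    intro q q' h h'
    simpa [add_mul, Finset.sum_add_distrib] using J.add_mem h h'
  zero_mem' := by simp
  smul_mem' := by
    intro a q h
    simpa [Finset.mul_sum, mul_assoc] using J.mul_mem_left a h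

variable (M : Type*) [AddCommGroup M] [Module F M] [DiffModule F M]

/-- The space of solutions in `M` of a left ideal `J` of `F[d_x, d_y]`, over the constants. -/
noncomputable def solutions (J : Ideal (DiffOp F)) : Submodule (constants F) M where
  carrier := {v | ∀ p ∈ J, p • v = 0}
  add_mem' := by
    intro v w hv hw p hp
    rw [smul_add, hv p hp, hw p hp, add_zero]
  zero_mem' := fun p _ => smul_zero p
  smul_mem' := by
    intro c v hv p hp
    rw [DiffOp.smul_constants_smul, hv p hp, smul_zero]

/-- The space of solutions in `M^t` of a submodule `U` of `F[d_x, d_y]^t`, over the constants. -/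
noncomputable def moduleSolutions {t : ℕ} (U : Submodule (DiffOp F) (Fin t → DiffOp F)) :
    Submodule (constants F) (Fin t → M) where
  carrier := {v | ∀ q ∈ U, ∑ i, q i • v i = 0}
  add_mem' := by
    intro v w hv hw q hq
    simp only [Pi.add_apply, smul_add, Finset.sum_add_distrib]
    rw [hv q hq, hw q hq, add_zero]
  zero_mem' := fun q _ => by simp
  smul_mem' := by
    intro c v hv q hq
    simp only [Pi.smul_apply, DiffOp.smul_constants_smul, ← Finset.smul_sum]
    rw [hv q hq, smul_zero]

end ideals

/-! ### Fractional-derivatives series -/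

/-- The data of a symbol `G = G_{s_2, …, s_k}(f_1, …, f_k)`, `k ≥ 1`, with elements `f_i` of `F` and
rationals `1 > s_2 > ⋯ > s_k > 0`. Indices are shifted by one, `k = length + 1`, and the convention
`s_1 = 1` is used. -/
structure FracSymbol (F : Type*) where
  length : ℕ
  f : Fin (length + 1) → F
  s : Fin (length + 1) → ℚ
  s_zero : s 0 = 1
  s_strictAnti : StrictAnti s
  s_pos : ∀ i, 0 < s i

namespace FracSymbol

variable {F : Type*}

/-- The (least) common denominator `q` of `s_2, …, s_k`. -/
def q (G : FracSymbol F) : ℕ := Finset.univ.lcm fun i => (G.s i).den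

theorem q_pos (G : FracSymbol F) : 0 < G.q :=
  Nat.pos_of_ne_zero fun h => by
    obtain ⟨i, -, hi⟩ := Finset.lcm_eq_zero_iff.1 h
    exact (G.s i).den_ne_zero hi

theorem exists_nat_s (G : FracSymbol F) (i : Fin (G.length + 1)) :
    ∃ n : ℕ, G.s i = 1 - n / G.q := by
  have hq : (G.q : ℚ) ≠ 0 := Nat.cast_ne_zero.2 G.q_pos.ne'
  obtain ⟨d, hd⟩ : (G.s i).den ∣ G.q := Finset.dvd_lcm (Finset.mem_univ i)
  have hm : G.s i * G.q = ((G.s i).num * d : ℤ) := by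
    rw [hd]
    push_cast
    rw [← mul_assoc, Rat.mul_den_eq_num]
  have hle : G.s i ≤ 1 := G.s_zero ▸ G.s_strictAnti.antitone (Fin.zero_le i)
  have hle' : ((G.s i).num * d : ℤ) ≤ (G.q : ℤ) := by
    have : G.s i * G.q ≤ 1 * G.q := mul_le_mul_of_nonneg_right hle (Nat.cast_nonneg _)
    rw [hm, one_mul] at this
    exact_mod_cast this
  obtain ⟨n, hn⟩ := Int.eq_ofNat_of_zero_le (sub_nonneg.2 hle')
  refine ⟨n, ?_⟩
  have hn' : (G.q : ℚ) - ((G.s i).num * d : ℤ) = n := by exact_mod_cast hn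
  field_simp
  rw [hm, ← hn']
  ring

/-- Formal (possibly infinite) sums `∑_{r ∈ ℚ} c_r G^{(r)}` with coefficients in `F`. -/
def Formal (_G : FracSymbol F) : Type _ := ℚ → F

variable [Field F]

instance (G : FracSymbol F) : AddCommGroup G.Formal := inferInstanceAs (AddCommGroup (ℚ → F))

instance (G : FracSymbol F) : Module F G.Formal := inferInstanceAs (Module F (ℚ → F))

/-- The coefficient of `G^{(r)}`. -/
def Formal.coeff {G : FracSymbol F} (c : G.Formal) (r : ℚ) : F := c r

/-- The derivation of formal sums by the rule
`d G^{(r)} = (d f_1) G^{(1 + r)} + (d f_2) G^{(s_2 + r)} + ⋯ + (d f_k) G^{(s_k + r)}`, read off at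
the coefficient of `G^{(r)}`. -/
def deriv (G : FracSymbol F) (d : Derivation ℤ F F) : G.Formal →+ G.Formal where
  toFun c := fun r => d (c.coeff r) + ∑ i, d (G.f i) * c.coeff (r - G.s i)
  map_zero' := by
    funext r
    change d 0 + ∑ i, d (G.f i) * 0 = 0
    simp
  map_add' := by
    intro c c'
    funext r
    change d (c.coeff r + c'.coeff r) +
        ∑ i, d (G.f i) * (c.coeff (r - G.s i) + c'.coeff (r - G.s i)) =
      (d (c.coeff r) + ∑ i, d (G.f i) * c.coeff (r - G.s i)) +
        (d (c'.coeff r) + ∑ i, d (G.f i) * c'.coeff (r - G.s i))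
    simp only [map_add, mul_add, Finset.sum_add_distrib]
    abel

theorem coeff_deriv (G : FracSymbol F) (d : Derivation ℤ F F) (c : G.Formal) (r : ℚ) :
    (G.deriv d c).coeff r = d (c.coeff r) + ∑ i, d (G.f i) * c.coeff (r - G.s i) := rfl

theorem deriv_smul (G : FracSymbol F) (d : Derivation ℤ F F) (a : F) (c : G.Formal) :
    G.deriv d (a • c) = d a • c + a • G.deriv d c := by
  funext r
  change d (a * c.coeff r) + ∑ i, d (G.f i) * (a * c.coeff (r - G.s i)) =
    d a * c.coeff r + a * (d (c.coeff r) + ∑ i, d (G.f i) * c.coeff (r - G.s i))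
  rw [Derivation.leibniz, smul_eq_mul, smul_eq_mul, mul_add, Finset.mul_sum,
    Finset.sum_congr rfl fun i _ => mul_left_comm (d (G.f i)) a (c.coeff (r - G.s i))]
  ring

theorem deriv_comm (G : FracSymbol F) (d d' : Derivation ℤ F F)
    (h : ∀ a, d (d' a) = d' (d a)) (c : G.Formal) :
    G.deriv d (G.deriv d' c) = G.deriv d' (G.deriv d c) := by
  funext r
  change (G.deriv d (G.deriv d' c)).coeff r = (G.deriv d' (G.deriv d c)).coeff r
  simp only [coeff_deriv, map_add, map_sum, Derivation.leibniz, smul_eq_mul, mul_add,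
    Finset.sum_add_distrib, Finset.mul_sum, h]
  have e : ∑ i, ∑ j, d (G.f i) * (d' (G.f j) * c.coeff (r - G.s i - G.s j)) =
      ∑ i, ∑ j, d' (G.f i) * (d (G.f j) * c.coeff (r - G.s i - G.s j)) := by
    rw [Finset.sum_comm]
    refine Finset.sum_congr rfl fun i _ => Finset.sum_congr rfl fun j _ => ?_
    rw [sub_right_comm, mul_left_comm]
  have e1 : ∑ i, c.coeff (r - G.s i) * d' (d (G.f i)) =
      ∑ i, d' (d (G.f i)) * c.coeff (r - G.s i) := by simp only [mul_comm]
  rw [e]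
  simp only [mul_comm (c.coeff _)]
  ring

/-- The `F`-space `V_G` of fractional-derivatives series `∑_{i ≥ 0} h_i G^{(s_0 - i/q)}`, where
`h_i ∈ F`, `s_0 q ∈ ℤ` and `q` is the common denominator of `s_2, …, s_k`; the series `0` is
included. -/
def series (G : FracSymbol F) : Submodule F G.Formal where
  carrier := {c | ∃ s₀ : ℚ, (∃ m : ℤ, s₀ * G.q = m) ∧
    ∀ r, c.coeff r ≠ 0 → ∃ i : ℕ, r = s₀ - i / G.q}
  add_mem' := by
    rintro c c' ⟨s₀, ⟨m, hm⟩, h⟩ ⟨s₀', ⟨m', hm'⟩, h'⟩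
    have hq : (G.q : ℚ) ≠ 0 := Nat.cast_ne_zero.2 G.q_pos.ne'
    refine ⟨(max m m' : ℤ) / G.q, ⟨max m m', by field_simp⟩, fun r hr => ?_⟩
    have hr' : c.coeff r ≠ 0 ∨ c'.coeff r ≠ 0 := by
      by_contra! hc
      apply hr
      change c.coeff r + c'.coeff r = 0
      rw [hc.1, hc.2, add_zero]
    have key : ∀ (s : ℚ) (l : ℤ) (i : ℕ), s * G.q = l → l ≤ max m m' → r = s - i / G.q →
        ∃ i : ℕ, r = (max m m' : ℤ) / G.q - i / G.q := by
      intro s l i hs hl hr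
      obtain ⟨n, hn⟩ := Int.eq_ofNat_of_zero_le (sub_nonneg.2 hl)
      have hn' : ((max m m' : ℤ) : ℚ) - l = n := by exact_mod_cast hn
      refine ⟨i + n, ?_⟩
      rw [hr]
      push_cast at hn' ⊢
      field_simp
      rw [hs, ← hn']
      ring
    rcases hr' with hr' | hr'
    · obtain ⟨i, hi⟩ := h r hr'
      exact key s₀ m i hm (le_max_left _ _) hi
    · obtain ⟨i, hi⟩ := h' r hr'
      exact key s₀' m' i hm' (le_max_right _ _) hi
  zero_mem' := ⟨0, ⟨0, by simp⟩, fun r hr => absurd rfl hr⟩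
  smul_mem' := by
    rintro a c ⟨s₀, hs, h⟩
    exact ⟨s₀, hs, fun r hr => h r fun h0 => hr (by change a * c.coeff r = 0; rw [h0, mul_zero])⟩

theorem deriv_mem (G : FracSymbol F) (d : Derivation ℤ F F) {c : G.Formal} (hc : c ∈ G.series) :
    G.deriv d c ∈ G.series := by
  obtain ⟨s₀, ⟨m, hm⟩, h⟩ := hc
  have hq : (G.q : ℚ) ≠ 0 := Nat.cast_ne_zero.2 G.q_pos.ne'
  refine ⟨s₀ + 1, ⟨m + G.q, by push_cast; rw [← hm]; ring⟩, fun r hr => ?_⟩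
  by_cases h0 : c.coeff r = 0
  · rw [coeff_deriv, h0, map_zero, zero_add] at hr
    obtain ⟨i, -, hi⟩ := Finset.exists_ne_zero_of_sum_ne_zero hr
    obtain ⟨j, hj⟩ := h _ (right_ne_zero_of_mul hi)
    obtain ⟨n, hn⟩ := G.exists_nat_s i
    refine ⟨j + n, ?_⟩
    rw [hn] at hj
    push_cast
    rw [add_div]
    linarith
  · obtain ⟨j, hj⟩ := h r h0
    refine ⟨j + G.q, ?_⟩
    push_cast
    rw [add_div, div_self hq]
    linarith

variable [PartialDiffField F]

/-- `V_G` is stable under the derivations, hence is a left `F[d_x, d_y]`-module. -/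
instance (G : FracSymbol F) : DiffModule F G.series where
  δx := (((G.deriv dx).comp G.series.subtype.toAddMonoidHom).codRestrict G.series)
    fun c => G.deriv_mem dx c.2
  δy := (((G.deriv dy).comp G.series.subtype.toAddMonoidHom).codRestrict G.series)
    fun c => G.deriv_mem dy c.2
  leibniz_x a c := Subtype.ext (G.deriv_smul dx a c)
  leibniz_y a c := Subtype.ext (G.deriv_smul dy a c)
  comm c := Subtype.ext (G.deriv_comm dx dy dx_dy_comm c)

end FracSymbol

end FDSeries

/-!
The map `v ↦ (p_1 v, …, p_t v)` kills exactly the solutions of `J₁`, so the point is surjectivity: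
given `w` in `V_G^t` annihilated by the relative syzygies, find `v` in `V_G` with `p_i v = w_i`. The
equations `(∑ q_i p_i) v = ∑ q_i w_i` form a linear system that is closed under linear combinations
and derivations, and it is compatible: it contains no equation `0 = c` with `c ≠ 0`, because `w`
satisfies the syzygies of `p`. Everything thus follows from the fact that compatible linear systems
have solutions in `V_G`, that is, that `V_G` is an injective left `F[d_x, d_y]`-module.

*Over `F`* (`DiffOp.solvesLinearSystems_of_isDifferentiallyClosed`). The generic solution of a
compatible system lives in a field of rational functions over `F`, whose variables form a basis of
the operators modulo the left-hand sides of the system; the two derivations extend there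
(`DiffOp.exists_extension_solution`). The left-hand sides are generated by finitely many
(`DiffOp.exists_finite_generators`, a Gröbner basis argument), so a solution exists in `F`.

*Over Laurent series `F((τ))`* with coefficientwise derivations (`Laurent.solvesLinearSystems`).
Among the equations consider those whose operator has coefficients in `F[[τ]]`. Their operators are
finitely generated, again by `DiffOp.exists_finite_generators`, so the pole orders of their
right-hand sides are bounded (`Laurent.exists_bound`). The lowest coefficient of a solution
satisfies the system reduced modulo `τ`, which is compatible because an operator over `F[[τ]]` with zero
residue is divisible by `τ` (`Laurent.exists_leading_coeff`). Subtracting and repeating gives all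
the coefficients.

*In `V_G`* (`FracSymbol.exists_solution`). Writing `T^r` for `G^{(r)}` identifies `V_G` with
`F((τ))`, `τ = T^{-1/q}`, where `d` acts by the coefficientwise derivation plus the multiplication
by `∑ (d f_i) T^{s_i}`. The substitution `d ↦ d + ∑ (d f_i) T^{s_i}` turns a system over `F` into one
over `F((τ))`, which stays compatible because the inverse substitution identifies it with an
extension of scalars (`DiffOp.exists_solution_of_twisted`).
-/

namespace FDSeries

open PartialDiffField

namespace DiffOp

/-! ### Coefficients of operators -/

section basics

variable {F : Type*} [Field F]

@[ext]
theorem ext_coeff {p q : DiffOp F} (h : ∀ i j, p.coeff i j = q.coeff i j) : p = q :=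
  Finsupp.ext fun ij => h ij.1 ij.2

@[simp]
theorem coeff_zero (i j : ℕ) : (0 : DiffOp F).coeff i j = 0 := rfl

@[simp]
theorem coeff_add (p q : DiffOp F) (i j : ℕ) : (p + q).coeff i j = p.coeff i j + q.coeff i j := rfl

@[simp]
theorem coeff_sub (p q : DiffOp F) (i j : ℕ) : (p - q).coeff i j = p.coeff i j - q.coeff i j :=
  Finsupp.sub_apply (G := F) p q (i, j)

@[simp]
theorem coeff_smul (a : F) (p : DiffOp F) (i j : ℕ) : (a • p).coeff i j = a * p.coeff i j := rfl

theorem coeff_monomial (a : F) (i j k l : ℕ) :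
    (monomial i j a).coeff k l = if (i, j) = (k, l) then a else 0 :=
  Finsupp.single_apply (M := F)

theorem finite_coeff_ne_zero (p : DiffOp F) : {ij : ℕ × ℕ | p.coeff ij.1 ij.2 ≠ 0}.Finite :=
  (show ℕ × ℕ →₀ F from p).hasFiniteSupport

theorem coeff_leftMul_x_zero (d : Derivation ℤ F F) (p : DiffOp F) (j : ℕ) :
    (leftMul d 1 0 p).coeff 0 j = d (p.coeff 0 j) := by
  induction p using induction_on with
  | h0 => simp
  | hadd p q hp hq => simp [hp, hq]
  | hmon i j a =>
    rw [leftMul_monomial]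
    simp only [coeff_add, coeff_monomial, Prod.mk.injEq]
    split_ifs <;> simp_all

theorem coeff_leftMul_x_succ (d : Derivation ℤ F F) (p : DiffOp F) (i j : ℕ) :
    (leftMul d 1 0 p).coeff (i + 1) j = d (p.coeff (i + 1) j) + p.coeff i j := by
  induction p using induction_on with
  | h0 => simp
  | hadd p q hp hq => simp [hp, hq]; abel
  | hmon i j a =>
    rw [leftMul_monomial]
    simp only [coeff_add, coeff_monomial, Prod.mk.injEq]
    split_ifs <;> simp_all

theorem coeff_leftMul_y_zero (d : Derivation ℤ F F) (p : DiffOp F) (i : ℕ) :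
    (leftMul d 0 1 p).coeff i 0 = d (p.coeff i 0) := by
  induction p using induction_on with
  | h0 => simp
  | hadd p q hp hq => simp [hp, hq]
  | hmon i j a =>
    rw [leftMul_monomial]
    simp only [coeff_add, coeff_monomial, Prod.mk.injEq]
    split_ifs <;> simp_all

theorem coeff_leftMul_y_succ (d : Derivation ℤ F F) (p : DiffOp F) (i j : ℕ) :
    (leftMul d 0 1 p).coeff i (j + 1) = d (p.coeff i (j + 1)) + p.coeff i j := by
  induction p using induction_on with
  | h0 => simp
  | hadd p q hp hq => simp [hp, hq]; abel
  | hmon i j a =>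
    rw [leftMul_monomial]
    simp only [coeff_add, coeff_monomial, Prod.mk.injEq]
    split_ifs <;> simp_all

end basics

/-! ### Leading terms and finite generation -/

section leading

variable {F : Type*} [Field F]

/-- All terms `a d_x^k d_y^l` of `p` have `(k, l) ≤ (i, j)` lexicographically. -/
def LexLE (p : DiffOp F) (i j : ℕ) : Prop :=
  ∀ k l, toLex (i, j) < toLex (k, l) → p.coeff k l = 0

theorem LexLE.leftMul_x {p : DiffOp F} {i j : ℕ} (h : p.LexLE i j) (d : Derivation ℤ F F) :
    (leftMul d 1 0 p).LexLE (i + 1) j ∧ (leftMul d 1 0 p).coeff (i + 1) j = p.coeff i j := by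
  have key : ∀ k l, toLex (i + 1, j) < toLex (k, l) → (leftMul d 1 0 p).coeff k l = 0 := by
    intro k l hkl
    rw [Prod.Lex.toLex_lt_toLex] at hkl
    dsimp only at hkl
    obtain _ | k := k
    · omega
    · rw [coeff_leftMul_x_succ, h, h, map_zero, add_zero] <;>
        rw [Prod.Lex.toLex_lt_toLex] <;> dsimp only <;> omega
  refine ⟨key, ?_⟩
  rw [coeff_leftMul_x_succ, h (i + 1) j, map_zero, zero_add]
  rw [Prod.Lex.toLex_lt_toLex]
  dsimp only
  omega

theorem LexLE.leftMul_y {p : DiffOp F} {i j : ℕ} (h : p.LexLE i j) (d : Derivation ℤ F F) :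
    (leftMul d 0 1 p).LexLE i (j + 1) ∧ (leftMul d 0 1 p).coeff i (j + 1) = p.coeff i j := by
  have key : ∀ k l, toLex (i, j + 1) < toLex (k, l) → (leftMul d 0 1 p).coeff k l = 0 := by
    intro k l hkl
    rw [Prod.Lex.toLex_lt_toLex] at hkl
    dsimp only at hkl
    obtain _ | l := l
    · rw [coeff_leftMul_y_zero, h, map_zero]
      rw [Prod.Lex.toLex_lt_toLex]
      dsimp only
      omega
    · rw [coeff_leftMul_y_succ, h, h, map_zero, add_zero] <;>
        rw [Prod.Lex.toLex_lt_toLex] <;> dsimp only <;> omega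
  refine ⟨key, ?_⟩
  rw [coeff_leftMul_y_succ, h i (j + 1), map_zero, zero_add]
  rw [Prod.Lex.toLex_lt_toLex]
  dsimp only
  omega

theorem exists_lexLE {p : DiffOp F} (hp : p ≠ 0) : ∃ i j, p.LexLE i j ∧ p.coeff i j ≠ 0 := by
  obtain ⟨ij, hij, hmax⟩ := p.finite_coeff_ne_zero.toFinset.exists_max_image
    (fun ij => toLex ij) (by
      by_contra hne
      refine hp (ext_coeff fun i j => ?_)
      by_contra h
      exact hne ⟨(i, j), by simpa using h⟩)
  refine ⟨ij.1, ij.2, fun k l hkl => ?_, by simpa using hij⟩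
  by_contra h
  exact absurd (hmax (k, l) (by simpa using h)) (not_le.2 hkl)

variable [PartialDiffField F]

/-- A group of operators is a left module over `O[d_x, d_y]`, for a ring `O` of coefficients. -/
structure IsStable (O : Subring F) (H : AddSubgroup (DiffOp F)) : Prop where
  smul_mem : ∀ a ∈ O, ∀ p ∈ H, a • p ∈ H
  x_mem : ∀ p ∈ H, leftMul dx 1 0 p ∈ H
  y_mem : ∀ p ∈ H, leftMul dy 0 1 p ∈ H

/-- Multiplying by `d_x^k d_y^l` shifts the leading exponent and keeps the leading coefficient. -/
theorem LexLE.exists_shift {O : Subring F} {p : DiffOp F} {i j : ℕ} (h : p.LexLE i j) (k l : ℕ) :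
    ∃ p' : DiffOp F, p'.LexLE (i + k) (j + l) ∧ p'.coeff (i + k) (j + l) = p.coeff i j ∧
      ∀ H : AddSubgroup (DiffOp F), IsStable O H → p ∈ H → p' ∈ H := by
  induction k with
  | zero =>
    induction l with
    | zero => exact ⟨p, h, rfl, fun _ _ hp => hp⟩
    | succ l ih =>
      obtain ⟨p', h1, h2, h3⟩ := ih
      exact ⟨leftMul dy 0 1 p', (h1.leftMul_y dy).1, (h1.leftMul_y dy).2.trans h2,
        fun H hH hp => hH.y_mem _ (h3 H hH hp)⟩
  | succ k ih =>
    obtain ⟨p', h1, h2, h3⟩ := ih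
    exact ⟨leftMul dx 1 0 p', (h1.leftMul_x dx).1, (h1.leftMul_x dx).2.trans h2,
      fun H hH hp => hH.x_mem _ (h3 H hH hp)⟩

/-- Noetherianity in the form of a finite Gröbner basis. The ring `O` of coefficients is the whole
field or a discrete valuation ring; in the second case the valuation of the leading coefficient is
recorded next to the leading exponent, and Dickson's lemma is applied to the triples. -/
theorem exists_finite_generators (O : Subring F) (v : F → ℕ)
    (hv : ∀ a ∈ O, ∀ b ∈ O, a ≠ 0 → v a ≤ v b → b / a ∈ O)
    (N : AddSubgroup (DiffOp F)) (hN : IsStable O N) (hNO : ∀ p ∈ N, ∀ i j, p.coeff i j ∈ O) :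
    ∃ S : Set (DiffOp F), S.Finite ∧ S ⊆ N ∧
      ∀ H : AddSubgroup (DiffOp F), IsStable O H → S ⊆ H → N ≤ H := by
  -- The exponents and valuations of leading terms. Those that are minimal for the product order
  -- are finitely many, and provide the basis.
  let T : Set (ℕ × ℕ × ℕ) := {e | ∃ p ∈ N, p.LexLE e.1 e.2.1 ∧ p.coeff e.1 e.2.1 ≠ 0 ∧
    v (p.coeff e.1 e.2.1) = e.2.2}
  have hT : T.IsPWO := Set.isPWO_of_wellQuasiOrderedLE T
  have hfin : {e | Minimal (· ∈ T) e}.Finite :=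
    WellQuasiOrderedLE.finite_of_isAntichain (setOfPred_minimal_antichain (· ∈ T))
  have hg : ∀ e ∈ T, ∃ p ∈ N, p.LexLE e.1 e.2.1 ∧ p.coeff e.1 e.2.1 ≠ 0 ∧
    v (p.coeff e.1 e.2.1) = e.2.2 := fun e he => he
  choose! g hgN hgle hgne hgv using hg
  refine ⟨g '' {e | Minimal (· ∈ T) e}, hfin.image g, ?_, fun H hH hSH => ?_⟩
  · rintro _ ⟨e, he, rfl⟩
    exact hgN e he.prop
  -- Reduction of `p` by the basis, by well-founded induction on a strict bound `α` of exponents.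
  have key : ∀ α : ℕ ×ₗ ℕ, ∀ p ∈ N, (∀ k l, α ≤ toLex (k, l) → p.coeff k l = 0) → p ∈ H := by
    intro α
    induction α using WellFoundedLT.induction with
    | _ α ih =>
      intro p hp hlt
      by_cases hp0 : p = 0
      · rw [hp0]; exact H.zero_mem
      obtain ⟨i, j, hle, hne⟩ := exists_lexLE hp0
      have hα : toLex (i, j) < α := by
        by_contra h
        exact hne (hlt i j (not_lt.1 h))
      obtain ⟨e, hea, he⟩ := hT.exists_le_minimal
        (show (i, j, v (p.coeff i j)) ∈ T from ⟨p, hp, hle, hne, rfl⟩)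
      have heT : e ∈ T := he.prop
      obtain ⟨h1, h2, h3⟩ : e.1 ≤ i ∧ e.2.1 ≤ j ∧ e.2.2 ≤ v (p.coeff i j) := hea
      obtain ⟨r, hr1, hr2, hr3⟩ := (hgle e heT).exists_shift (O := O) (i - e.1) (j - e.2.1)
      rw [Nat.add_sub_cancel' h1, Nat.add_sub_cancel' h2] at hr1 hr2
      have hc : p.coeff i j / (g e).coeff e.1 e.2.1 ∈ O :=
        hv _ (hNO _ (hgN e heT) _ _) _ (hNO _ hp _ _) (hgne e heT) (by rwa [hgv e heT])
      set c := p.coeff i j / (g e).coeff e.1 e.2.1 with hc_def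
      have hrH : c • r ∈ H :=
        hH.smul_mem _ hc _ (hr3 H hH (hSH (Set.mem_image_of_mem g he)))
      have hrN : c • r ∈ N := hN.smul_mem _ hc _ (hr3 N hN (hgN e heT))
      have hsub : p - c • r ∈ H := by
        refine ih _ hα _ (N.sub_mem hp hrN) fun k l hkl => ?_
        rcases hkl.eq_or_lt with h | h
        · obtain ⟨rfl, rfl⟩ : i = k ∧ j = l := by simpa using h
          rw [coeff_sub, coeff_smul, hr2, hc_def, div_mul_cancel₀ _ (hgne e heT), sub_self]
        · rw [coeff_sub, coeff_smul, hle k l h, hr1 k l h, mul_zero, sub_zero]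
      simpa using H.add_mem hsub hrH
  intro p hp
  by_cases hp0 : p = 0
  · rw [hp0]; exact H.zero_mem
  obtain ⟨i, j, hle, -⟩ := exists_lexLE hp0
  refine key (toLex (i, j + 1)) p hp fun k l hkl => hle k l (lt_of_lt_of_le ?_ hkl)
  rw [Prod.Lex.toLex_lt_toLex]
  dsimp only
  omega

end leading

/-! ### Compatible linear systems -/

section systems

variable (F : Type*) [Field F] [PartialDiffField F]

/-- The field itself as a module over its operators. -/
noncomputable abbrev fieldModule : DiffModule F F where
  δx := (dx : Derivation ℤ F F).toLinearMap.toAddMonoidHom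
  δy := (dy : Derivation ℤ F F).toLinearMap.toAddMonoidHom
  leibniz_x a m := by
    change dx (a * m) = dx a * m + a * dx m
    rw [Derivation.leibniz, smul_eq_mul, smul_eq_mul]; ring
  leibniz_y a m := by
    change dy (a * m) = dy a * m + a * dy m
    rw [Derivation.leibniz, smul_eq_mul, smul_eq_mul]; ring
  comm := dx_dy_comm

variable {F}

/-- A linear system of equations `p y = v`, for the pairs `(p, v) ∈ Γ`, for one unknown `y`. It is
closed under `F`-linear combinations and derivations, and compatible: it does not contain any
equation `0 = v` with `v ≠ 0`. -/
structure IsCompatible (Γ : Submodule F (DiffOp F × F)) : Prop where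
  x_mem : ∀ p v, (p, v) ∈ Γ → (leftMul dx 1 0 p, dx v) ∈ Γ
  y_mem : ∀ p v, (p, v) ∈ Γ → (leftMul dy 0 1 p, dy v) ∈ Γ
  eq_zero : ∀ v, (0, v) ∈ Γ → v = 0

variable (F) in
/-- Every compatible linear system over `F` has a solution in `F`; in other words, `F` is an
injective left `F[d_x, d_y]`-module. -/
def SolvesLinearSystems : Prop :=
  ∀ Γ : Submodule F (DiffOp F × F), IsCompatible Γ →
    ∃ y : F, ∀ p v, (p, v) ∈ Γ → act (fieldModule F) p y = v

theorem act_leftMul_x {M : Type*} [AddCommGroup M] [Module F M] (S : DiffModule F M)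
    (p : DiffOp F) (m : M) : act S (leftMul dx 1 0 p) m = S.δx (act S p m) := act_δx S p m

theorem act_leftMul_y {M : Type*} [AddCommGroup M] [Module F M] (S : DiffModule F M)
    (p : DiffOp F) (m : M) : act S (leftMul dy 0 1 p) m = S.δy (act S p m) := act_δy S p m

end systems

end DiffOp

/-- A subspace of `U × V` that is the graph of a partial map is contained in the graph of a
linear map. -/
theorem exists_linearMap_of_graph {k U V : Type*} [Field k] [AddCommGroup U] [Module k U]
    [AddCommGroup V] [Module k V] (Γ : Submodule k (U × V)) (h : ∀ v, (0, v) ∈ Γ → v = 0) :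
    ∃ l : U →ₗ[k] V, ∀ u v, (u, v) ∈ Γ → l u = v := by
  have hΓ : ∀ x ∈ Γ, x.1 = 0 → x.2 = 0 := by
    rintro ⟨u, v⟩ hx rfl
    exact h v hx
  obtain ⟨l, hl⟩ := LinearMap.exists_extend Γ.toLinearPMap.toFun
  refine ⟨l, fun u v huv => ?_⟩
  rw [← Γ.toLinearPMap_graph_eq hΓ, LinearPMap.mem_graph_iff] at huv
  obtain ⟨w, rfl, rfl⟩ := huv
  exact LinearMap.congr_fun hl w

end FDSeries

namespace FDSeries

/-! ### Derivations of rational function fields -/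

open PartialDiffField

/-- A ring homomorphism `E → E[ε]` lifting the identity is `a ↦ a + ε D a` for a derivation `D`. -/
def derivationOfDualNumberHom {E : Type*} [CommRing E] (f : E →+* TrivSqZeroExt E E)
    (hf : ∀ a, (f a).fst = a) : Derivation ℤ E E :=
  Derivation.mk' ((TrivSqZeroExt.sndHom E E).toAddMonoidHom.comp f.toAddMonoidHom).toIntLinearMap
    fun a b => by
      change (f (a * b)).snd = a • (f b).snd + b • (f a).snd
      rw [map_mul, TrivSqZeroExt.snd_mul, hf, hf, op_smul_eq_smul]

theorem derivationOfDualNumberHom_apply {E : Type*} [CommRing E] (f : E →+* TrivSqZeroExt E E)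
    (hf : ∀ a, (f a).fst = a) (a : E) : derivationOfDualNumberHom f hf a = (f a).snd := rfl

section rationalFunctions

variable {F ι E : Type*} [Field F] [Field E] [Algebra (MvPolynomial ι F) E]
  [IsFractionRing (MvPolynomial ι F) E]

/-- A derivation of `F` extends to rational functions over `F`, with arbitrary values at the
variables. -/
theorem exists_derivation_fractionRing (d : Derivation ℤ F F)
    (g : ι → E) : ∃ D : Derivation ℤ E E,
      (∀ c, D (algebraMap (MvPolynomial ι F) _ (MvPolynomial.C c)) =
        algebraMap (MvPolynomial ι F) _ (MvPolynomial.C (d c))) ∧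
      ∀ i, D (algebraMap (MvPolynomial ι F) _ (MvPolynomial.X i)) = g i := by
  let e : MvPolynomial ι F →+* E := algebraMap _ _
  let f₀ : F →+* TrivSqZeroExt E E :=
    { toFun := fun c => .inl (e (.C c)) + .inr (e (.C (d c)))
      map_one' := by simp
      map_zero' := by simp
      map_add' := fun a b => by
        ext <;> simp
      map_mul' := fun a b => by
        ext
        · simp
        · simp [Derivation.leibniz, mul_comm (e (.C b))] }
  let f₁ : MvPolynomial ι F →+* TrivSqZeroExt E E :=
    MvPolynomial.eval₂Hom f₀ fun i => .inl (e (.X i)) + .inr (g i)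
  have h₁ : ∀ a, (f₁ a).fst = e a := by
    intro a
    have : (TrivSqZeroExt.fstHom E E E).toRingHom.comp f₁ = e := by
      refine MvPolynomial.ringHom_ext (fun c => ?_) fun i => ?_
      · simp [f₁, f₀]
      · simp [f₁]
    exact RingHom.congr_fun this a
  have hu : ∀ s : nonZeroDivisors (MvPolynomial ι F), IsUnit (f₁ s) := by
    intro s
    rw [TrivSqZeroExt.isUnit_iff_isUnit_fst, h₁]
    exact IsLocalization.map_units E s
  let f₂ : E →+* TrivSqZeroExt E E := IsLocalization.lift hu
  have h₂ : ∀ a, f₂ (e a) = f₁ a := fun a => IsLocalization.lift_eq hu a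
  have h₃ : ∀ a, (f₂ a).fst = a := by
    intro a
    have : (TrivSqZeroExt.fstHom E E E).toRingHom.comp f₂ = RingHom.id E := by
      refine IsLocalization.ringHom_ext (nonZeroDivisors (MvPolynomial ι F)) ?_
      refine RingHom.ext fun a => ?_
      exact (congrArg _ (h₂ a)).trans (h₁ a)
    exact RingHom.congr_fun this a
  refine ⟨derivationOfDualNumberHom f₂ h₃, fun c => ?_, fun i => ?_⟩
  · rw [derivationOfDualNumberHom_apply]
    refine (congrArg _ (h₂ _)).trans ?_
    change (f₁ (.C c)).snd = e (.C (d c))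
    simp [f₁, f₀]
  · rw [derivationOfDualNumberHom_apply]
    refine (congrArg _ (h₂ _)).trans ?_
    simp [f₁]

/-- A derivation of a field of rational functions vanishes if it kills constants and variables. -/
theorem derivation_fractionRing_eq_zero
    (D : Derivation ℤ E E)
    (hC : ∀ c, D (algebraMap (MvPolynomial ι F) _ (MvPolynomial.C c)) = 0)
    (hX : ∀ i, D (algebraMap (MvPolynomial ι F) _ (MvPolynomial.X i)) = 0)
    (a : E) : D a = 0 := by
  have key : ∀ b, D (algebraMap (MvPolynomial ι F) _ b) = 0 := by
    intro b
    induction b using MvPolynomial.induction_on with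
    | C c => exact hC c
    | add p q hp hq => rw [map_add, map_add, hp, hq, add_zero]
    | mul_X p i hp => rw [map_mul, Derivation.leibniz, hp, hX, smul_zero, smul_zero, add_zero]
  obtain ⟨x, y, hy, rfl⟩ := IsFractionRing.div_surjective (A := MvPolynomial ι F) a
  rw [Derivation.leibniz_div, key, key]
  simp

end rationalFunctions

end FDSeries

namespace FDSeries

/-! ### Linear systems over differentially closed fields -/

open PartialDiffField

namespace DiffOp

section closed

/-- The linear differential polynomial `∑ a_{ij} d_x^i d_y^j u` of an operator. -/
noncomputable def linearPoly (F : Type u) [Field F] :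
    DiffOp F →+ MvPolynomial (Fin 1 × ℕ × ℕ) F :=
  Finsupp.liftAddHom (M := F) fun ij : ℕ × ℕ =>
    (AddMonoidHom.mulRight (MvPolynomial.X (0, ij))).comp MvPolynomial.C.toAddMonoidHom

theorem linearPoly_monomial {F : Type u} [Field F] (i j : ℕ) (a : F) :
    linearPoly F (monomial i j a) = MvPolynomial.C a * MvPolynomial.X (0, i, j) :=
  Finsupp.liftAddHom_apply_single (M := F) _ _ _

variable {F : Type u} [Field F] [PartialDiffField F]

theorem pow_δ_fieldModule (i j : ℕ) (y : F) :
    ((fieldModule F).δx ^ i * (fieldModule F).δy ^ j : AddMonoid.End F) y =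
      dx^[i] (dy^[j] y) := by
  rw [end_mul_apply, AddMonoid.End.coe_pow, AddMonoid.End.coe_pow]
  rfl

theorem evalDiffPoly_linearPoly_id (a : Fin 1 → F) (p : DiffOp F) :
    evalDiffPoly (RingHom.id F) a (linearPoly F p) = act (fieldModule F) p (a 0) := by
  induction p using induction_on with
  | h0 => simp [evalDiffPoly]
  | hadd p q hp hq =>
    rw [map_add, map_add, AddMonoidHom.add_apply, ← hp, ← hq]
    exact MvPolynomial.eval₂_add _ _
  | hmon i j b =>
    rw [linearPoly_monomial, act_monomial, pow_δ_fieldModule]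
    simp [evalDiffPoly]

/-- A compatible linear system has a solution in a differential field extension. Adjoining a generic
solution gives the rational functions in variables that form a basis of the operators modulo
the left-hand sides of the system. -/
theorem exists_extension_solution {Γ : Submodule F (DiffOp F × F)} (hΓ : IsCompatible Γ) :
    ∃ (E : Type u) (_ : Field E) (_ : PartialDiffField E) (φ : F →+* E),
      (∀ a, φ (dx a) = dx (φ a)) ∧ (∀ a, φ (dy a) = dy (φ a)) ∧
      ∃ y : E, ∀ p v, (p, v) ∈ Γ → evalDiffPoly φ (fun _ : Fin 1 => y) (linearPoly F p) = φ v := by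
  obtain ⟨l, hl⟩ := exists_linearMap_of_graph Γ hΓ.eq_zero
  let I : Submodule F (DiffOp F) := Γ.map (LinearMap.fst F _ _)
  let b := Module.Basis.ofVectorSpace F (DiffOp F ⧸ I)
  let ι := Module.Basis.ofVectorSpaceIndex F (DiffOp F ⧸ I)
  let A := MvPolynomial ι F
  obtain ⟨E, _, _, _⟩ : ∃ (E : Type u) (_ : Field E) (_ : Algebra A E), IsFractionRing A E :=
    ⟨FractionRing A, inferInstance, inferInstance, inferInstance⟩
  let e : A →+* E := algebraMap A E
  -- `L p` is the value of the operator `p` at the generic solution.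
  let L : DiffOp F →ₗ[F] A :=
    (Algebra.linearMap F A).comp l + (b.constr F fun i : ι => (MvPolynomial.X i : A)).comp I.mkQ
  have hLΓ : ∀ p v, (p, v) ∈ Γ → L p = MvPolynomial.C v := by
    intro p v hpv
    have hp : I.mkQ p = 0 := by
      rw [Submodule.mkQ_apply, Submodule.Quotient.mk_eq_zero]
      exact ⟨_, hpv, rfl⟩
    change MvPolynomial.C (l p) + b.constr F _ (I.mkQ p) = _
    rw [hp, map_zero, add_zero, hl p v hpv]
  have hLs : ∀ a p, L (a • p) = MvPolynomial.C a * L p := by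
    intro a p
    rw [map_smul, MvPolynomial.smul_eq_C_mul]
  choose P hP using fun i : ι => I.mkQ_surjective (b i)
  have hLP : ∀ i, L (P i) = MvPolynomial.C (l (P i)) + MvPolynomial.X i := by
    intro i
    change MvPolynomial.C (l (P i)) + b.constr F _ (I.mkQ (P i)) = _
    rw [hP, Module.Basis.constr_basis]
  have hD : ∀ (d : Derivation ℤ F F) (k m : ℕ),
      (∀ p v, (p, v) ∈ Γ → (leftMul d k m p, d v) ∈ Γ) →
      ∃ D : Derivation ℤ E E, (∀ c, D (e (.C c)) = e (.C (d c))) ∧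
        ∀ p, D (e (L p)) = e (L (leftMul d k m p)) := by
    intro d k m hd
    obtain ⟨D, hDC, hDX⟩ := exists_derivation_fractionRing (E := E) d
      fun i => e (L (leftMul d k m (P i))) - e (.C (d (l (P i))))
    refine ⟨D, hDC, ?_⟩
    -- `D` was prescribed on the values of the lifts `P i` of the basis; it is right on all
    -- operators, since these are spanned by the `P i` and the left-hand sides of the system.
    let W : Submodule F (DiffOp F) :=
      { carrier := {p | D (e (L p)) = e (L (leftMul d k m p))}
        zero_mem' := by simp
        add_mem' := by
          intro p q (hp : _ = _) (hq : _ = _)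
          change D (e (L (p + q))) = e (L (leftMul d k m (p + q)))
          simp only [map_add, hp, hq]
        smul_mem' := by
          intro a p (hp : _ = _)
          change D (e (L (a • p))) = e (L (leftMul d k m (a • p)))
          rw [leftMul_smul, map_add, hLs, hLs, hLs, map_mul, Derivation.leibniz, hp, hDC, map_add,
            map_mul, map_mul, smul_eq_mul, smul_eq_mul]
          ring }
    have hIW : I ≤ W := by
      rintro _ ⟨⟨p, v⟩, hpv, rfl⟩
      change D (e (L p)) = e (L (leftMul d k m p))
      rw [hLΓ p v hpv, hLΓ _ _ (hd p v hpv)]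
      exact hDC v
    have hPW : ∀ i, P i ∈ W := by
      intro i
      change D (e (L (P i))) = e (L (leftMul d k m (P i)))
      rw [hLP, map_add, map_add, hDC, hDX]
      ring
    have hW : W = ⊤ := by
      have h1 : W.map I.mkQ = ⊤ := by
        rw [eq_top_iff, ← b.span_eq, Submodule.span_le]
        rintro _ ⟨i, rfl⟩
        exact ⟨P i, hPW i, hP i⟩
      rw [Submodule.map_mkQ_eq_top] at h1
      rwa [sup_eq_right.2 hIW] at h1
    intro p
    have hp : p ∈ W := by rw [hW]; exact Submodule.mem_top
    exact hp
  obtain ⟨Dx, hxC, hxL⟩ := hD dx 1 0 hΓ.x_mem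
  obtain ⟨Dy, hyC, hyL⟩ := hD dy 0 1 hΓ.y_mem
  have hX : ∀ i, e (.X i) = e (L (P i)) - e (.C (l (P i))) := by
    intro i
    rw [hLP, map_add]
    ring
  -- The commutator is a derivation, so it is enough to evaluate it at constants and variables.
  have hcomm : ∀ a, ⁅Dx, Dy⁆ a = 0 := by
    refine derivation_fractionRing_eq_zero (F := F) (ι := ι) _ (fun c => ?_) fun i => ?_
    · rw [Derivation.commutator_apply]
      change Dx (Dy (e (.C c))) - Dy (Dx (e (.C c))) = 0
      rw [hyC, hxC, hxC, hyC, dx_dy_comm, sub_self]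
    · rw [Derivation.commutator_apply]
      change Dx (Dy (e (.X i))) - Dy (Dx (e (.X i))) = 0
      rw [hX]
      simp only [map_sub, hxC, hyC, hxL, hyL, dx_dy_comm]
      rw [show leftMul dx 1 0 (leftMul dy 0 1 (P i)) = leftMul dy 0 1 (leftMul dx 1 0 (P i)) from
        (selfModule F).comm (P i)]
      ring
  let _ : PartialDiffField E :=
    { dx := Dx
      dy := Dy
      dx_dy_comm := fun a => by
        have := hcomm a
        rwa [Derivation.commutator_apply, sub_eq_zero] at this }
  refine ⟨E, inferInstance, inferInstance, e.comp MvPolynomial.C, fun a => (hxC a).symm,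
    fun a => (hyC a).symm, e (L (monomial 0 0 1)), fun p v hpv => ?_⟩
  have hy : ∀ j, Dy^[j] (e (L (monomial 0 0 1))) = e (L (monomial 0 j 1)) := by
    intro j
    induction j with
    | zero => rfl
    | succ j ih =>
      rw [Function.iterate_succ_apply', ih, hyL, leftMul_monomial]
      simp
  have hxy : ∀ i j, Dx^[i] (Dy^[j] (e (L (monomial 0 0 1)))) = e (L (monomial i j 1)) := by
    intro i j
    induction i with
    | zero => exact hy j
    | succ i ih =>
      rw [Function.iterate_succ_apply', ih, hxL, leftMul_monomial]
      simp
  have key : ∀ q : DiffOp F, evalDiffPoly (e.comp MvPolynomial.C)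
      (fun _ : Fin 1 => e (L (monomial 0 0 1))) (linearPoly F q) = e (L q) := by
    intro q
    induction q using induction_on with
    | h0 => simp [evalDiffPoly]
    | hadd p q hp hq =>
      rw [map_add, map_add, map_add, ← hp, ← hq]
      exact MvPolynomial.eval₂_add _ _
    | hmon i j b =>
      have h1 : (monomial i j b : DiffOp F) = b • monomial i j 1 := by
        rw [smul_monomial, mul_one]
      rw [linearPoly_monomial, h1, hLs, map_mul, ← hxy i j]
      exact (MvPolynomial.eval₂_mul _ _).trans (by
        rw [MvPolynomial.eval₂_C, MvPolynomial.eval₂_X]; rfl)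
  rw [key, hLΓ p v hpv]
  rfl

/-- A differentially closed field is an injective module over its operators: a generic solution
exists in an extension, and finitely many equations of the system imply the others. -/
theorem solvesLinearSystems_of_isDifferentiallyClosed (hF : IsDifferentiallyClosed F) :
    SolvesLinearSystems F := by
  classical
  intro Γ hΓ
  obtain ⟨l, hl⟩ := exists_linearMap_of_graph Γ hΓ.eq_zero
  let I : Submodule F (DiffOp F) := Γ.map (LinearMap.fst F _ _)
  have hI : ∀ p, p ∈ I ↔ (p, l p) ∈ Γ := by
    refine fun p => ⟨?_, fun h => ⟨_, h, rfl⟩⟩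
    rintro ⟨⟨p, v⟩, hpv, rfl⟩
    change (p, l p) ∈ Γ
    rwa [hl p v hpv]
  have hIst : IsStable ⊤ I.toAddSubgroup :=
    { smul_mem := fun a _ p hp => I.smul_mem a hp
      x_mem := fun p hp => ⟨_, hΓ.x_mem _ _ ((hI p).1 hp), rfl⟩
      y_mem := fun p hp => ⟨_, hΓ.y_mem _ _ ((hI p).1 hp), rfl⟩ }
  obtain ⟨S, hSfin, hSI, hS⟩ := exists_finite_generators ⊤ (fun _ => 0)
    (fun _ _ _ _ _ _ => Subring.mem_top _) I.toAddSubgroup hIst fun _ _ _ _ => Subring.mem_top _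
  obtain ⟨E, _, _, φ, hφx, hφy, y, hy⟩ := exists_extension_solution hΓ
  obtain ⟨a, ha, -⟩ := hF E φ hφx hφy 1
    (hSfin.toFinset.image fun p => linearPoly F p - MvPolynomial.C (l p)) 1
    ⟨fun _ => y, by
      intro Q hQ
      obtain ⟨p, hp, rfl⟩ := Finset.mem_image.1 hQ
      have hp' := hy p _ ((hI p).1 (hSI (hSfin.mem_toFinset.1 hp)))
      have h1 := MvPolynomial.eval₂_sub (linearPoly F p) (q := .C (l p)) φ
        fun v : Fin 1 × ℕ × ℕ => dx^[v.2.1] (dy^[v.2.2] y)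
      refine h1.trans ?_
      rw [MvPolynomial.eval₂_C, sub_eq_zero]
      exact hp', by simp [evalDiffPoly]⟩
  -- The operators whose equation holds for `a 0`: they form a left module containing `S`.
  let H : AddSubgroup (DiffOp F) :=
    { carrier := {p | p ∈ I ∧ act (fieldModule F) p (a 0) = l p}
      zero_mem' := ⟨I.zero_mem, by simp⟩
      add_mem' := by
        rintro p q ⟨hp, hp'⟩ ⟨hq, hq'⟩
        exact ⟨I.add_mem hp hq, by rw [map_add, map_add, AddMonoidHom.add_apply, hp', hq']⟩
      neg_mem' := by
        rintro p ⟨hp, hp'⟩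
        exact ⟨I.neg_mem hp, by rw [map_neg, map_neg, AddMonoidHom.neg_apply, hp']⟩ }
  have hH : IsStable ⊤ H :=
    { smul_mem := fun b _ p hp => ⟨I.smul_mem b hp.1, by
        rw [act_smul, hp.2, map_smul]⟩
      x_mem := fun p hp => ⟨hIst.x_mem p hp.1, by
        rw [act_leftMul_x, hp.2, hl _ _ (hΓ.x_mem _ _ ((hI p).1 hp.1))]
        rfl⟩
      y_mem := fun p hp => ⟨hIst.y_mem p hp.1, by
        rw [act_leftMul_y, hp.2, hl _ _ (hΓ.y_mem _ _ ((hI p).1 hp.1))]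
        rfl⟩ }
  have hSH : S ⊆ H := by
    intro p hp
    refine ⟨hSI hp, ?_⟩
    have h := ha _ (Finset.mem_image_of_mem _ (hSfin.mem_toFinset.2 hp))
    have h1 := MvPolynomial.eval₂_sub (linearPoly F p) (q := .C (l p)) (RingHom.id F)
      fun v : Fin 1 × ℕ × ℕ => dx^[v.2.1] (dy^[v.2.2] (a v.1))
    have h2 := h1.symm.trans h
    rw [MvPolynomial.eval₂_C, sub_eq_zero] at h2
    exact (evalDiffPoly_linearPoly_id a p).symm.trans h2
  refine ⟨a 0, fun p v hpv => ?_⟩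
  rw [← hl p v hpv]
  exact (hS H hH hSH ((hI p).2 (by rwa [hl p v hpv]))).2

end closed

end DiffOp

end FDSeries

namespace FDSeries

/-! ### Linear systems over Laurent series -/

open PartialDiffField

namespace Laurent

section derivation

variable {F : Type*} [Field F]

/-- An additive map obeying the Leibniz rule, as a derivation over `ℤ`. -/
def derivationOfLeibniz {E : Type*} [Field E] (f : E →+ E)
    (h : ∀ a b, f (a * b) = a * f b + b * f a) : Derivation ℤ E E :=
  Derivation.mk' f.toIntLinearMap h

/-- The coefficientwise action of a derivation on Laurent series. -/
noncomputable def mapCoeffHom (d : Derivation ℤ F F) : LaurentSeries F →+ LaurentSeries F where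
  toFun a := HahnSeries.map a d
  map_zero' := by ext n; exact map_zero d
  map_add' a b := by ext n; exact map_add d _ _

theorem coeff_mapCoeffHom (d : Derivation ℤ F F) (a : LaurentSeries F) (n : ℤ) :
    (mapCoeffHom d a).coeff n = d (a.coeff n) := rfl

theorem mapCoeffHom_mul (d : Derivation ℤ F F) (a b : LaurentSeries F) :
    mapCoeffHom d (a * b) = a * mapCoeffHom d b + b * mapCoeffHom d a := by
  have hs : ∀ c : LaurentSeries F, (mapCoeffHom d c).support ⊆ c.support := by
    intro c n hn hc
    exact hn ((congrArg d hc).trans (map_zero d))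
  ext n
  rw [mul_comm b, HahnSeries.coeff_add, coeff_mapCoeffHom, HahnSeries.coeff_mul,
    HahnSeries.coeff_mul_right' b.isPWO_support (hs b),
    HahnSeries.coeff_mul_left' a.isPWO_support (hs a), map_sum, ← Finset.sum_add_distrib]
  refine Finset.sum_congr rfl fun ij _ => ?_
  rw [Derivation.leibniz, coeff_mapCoeffHom, coeff_mapCoeffHom, smul_eq_mul, smul_eq_mul,
    mul_comm (b.coeff _)]

/-- The derivations act on Laurent series coefficientwise; the variable is a constant. -/
noncomputable instance [PartialDiffField F] : PartialDiffField (LaurentSeries F) where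
  dx := derivationOfLeibniz (mapCoeffHom dx) (mapCoeffHom_mul dx)
  dy := derivationOfLeibniz (mapCoeffHom dy) (mapCoeffHom_mul dy)
  dx_dy_comm a := by ext n; exact dx_dy_comm (a.coeff n)

variable [PartialDiffField F]

theorem coeff_dx (a : LaurentSeries F) (n : ℤ) : (dx a).coeff n = dx (a.coeff n) := rfl

theorem coeff_dy (a : LaurentSeries F) (n : ℤ) : (dy a).coeff n = dy (a.coeff n) := rfl

end derivation

section filtration

variable (F : Type*) [Field F]

/-- The Laurent series of order at least `m`. -/
def orderGE (m : ℤ) : AddSubgroup (LaurentSeries F) where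
  carrier := {a | ∀ n < m, a.coeff n = 0}
  zero_mem' := fun _ _ => rfl
  add_mem' := fun {a b} ha hb n hn => by rw [HahnSeries.coeff_add, ha n hn, hb n hn, add_zero]
  neg_mem' := fun {a} ha n hn => by rw [HahnSeries.coeff_neg, ha n hn, neg_zero]

variable {F}

theorem orderGE_mono {m n : ℤ} (h : m ≤ n) : orderGE F n ≤ orderGE F m :=
  fun _ ha k hk => ha k (hk.trans_le h)

/-- Orders add up in products, and the coefficients at the bounds multiply. -/
theorem mul_mem_orderGE {m n : ℤ} {a b : LaurentSeries F} (ha : a ∈ orderGE F m)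
    (hb : b ∈ orderGE F n) :
    a * b ∈ orderGE F (m + n) ∧ (a * b).coeff (m + n) = a.coeff m * b.coeff n := by
  have ha' : ∀ i, a.coeff i ≠ 0 → m ≤ i := fun i hi => not_lt.1 fun h => hi (ha i h)
  have hb' : ∀ i, b.coeff i ≠ 0 → n ≤ i := fun i hi => not_lt.1 fun h => hi (hb i h)
  refine ⟨fun k hk => ?_, ?_⟩
  · rw [HahnSeries.coeff_mul]
    refine Finset.sum_eq_zero fun ij hij => ?_
    rw [Finset.mem_antidiagonal] at hij
    have := ha' _ hij.1
    have := hb' _ hij.2.1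
    omega
  · rw [HahnSeries.coeff_mul]
    refine Finset.sum_eq_single (m, n) (fun ij hij hne => ?_) fun h => ?_
    · rw [Finset.mem_antidiagonal] at hij
      have h1 := ha' _ hij.1
      have h2 := hb' _ hij.2.1
      exact absurd (Prod.ext (by dsimp only; omega) (by dsimp only; omega)) hne
    · by_contra hne
      refine h (Finset.mem_antidiagonal.2 ⟨left_ne_zero_of_mul hne, right_ne_zero_of_mul hne, rfl⟩)

theorem exists_mem_orderGE (a : LaurentSeries F) : ∃ m, a ∈ orderGE F m :=
  ⟨a.order, fun _ hn => HahnSeries.coeff_eq_zero_of_lt_order hn⟩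

variable (F) in
/-- The ring of power series, inside the field of Laurent series. -/
def powerSeries : Subring (LaurentSeries F) where
  carrier := orderGE F 0
  mul_mem' ha hb := by simpa using (mul_mem_orderGE ha hb).1
  one_mem' := fun n hn => by rw [HahnSeries.coeff_one, if_neg hn.ne]
  add_mem' := (orderGE F 0).add_mem
  zero_mem' := (orderGE F 0).zero_mem
  neg_mem' := (orderGE F 0).neg_mem

theorem zero_le_order {a : LaurentSeries F} (ha : a ∈ powerSeries F) (h0 : a ≠ 0) :
    0 ≤ a.order := by
  by_contra! h
  exact h0 (HahnSeries.coeff_order_eq_zero.1 (ha _ h))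

/-- Power series form a valuation ring. As `order 0 = 0`, the case `b = 0` is covered. -/
theorem div_mem_powerSeries {a b : LaurentSeries F} (ha : a ∈ powerSeries F)
    (hb : b ∈ powerSeries F) (h0 : a ≠ 0) (h : a.order.toNat ≤ b.order.toNat) :
    b / a ∈ powerSeries F := by
  by_cases hb0 : b = 0
  · rw [hb0, zero_div]; exact Subring.zero_mem _
  have h1 := zero_le_order ha h0
  have h2 := zero_le_order hb hb0
  have h3 : b / a * a = b := div_mul_cancel₀ b h0
  have h4 := HahnSeries.order_mul (div_ne_zero hb0 h0) h0
  rw [h3] at h4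
  have h5 : 0 ≤ (b / a).order := by omega
  exact fun n hn => HahnSeries.coeff_eq_zero_of_lt_order (hn.trans_le h5)

theorem single_mem_powerSeries {k : ℤ} (hk : 0 ≤ k) (a : F) :
    HahnSeries.single k a ∈ powerSeries F := fun n hn =>
  HahnSeries.coeff_single_of_ne (by omega)

theorem single_mul_mem_orderGE (k : ℤ) {m : ℤ} {a : LaurentSeries F} (ha : a ∈ orderGE F m) :
    HahnSeries.single k (1 : F) * a ∈ orderGE F (k + m) := by
  intro n hn
  rw [HahnSeries.coeff_single_mul, ha _ (by omega), mul_zero]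

end filtration

section residue

open DiffOp

variable {F : Type*} [Field F]

/-- The operator obtained from an operator over Laurent series by taking constant coefficients. -/
noncomputable def residue : DiffOp (LaurentSeries F) →+ DiffOp F :=
  Finsupp.mapRange.addMonoidHom (M := LaurentSeries F) (N := F)
    { toFun := fun a : LaurentSeries F => a.coeff 0
      map_zero' := rfl
      map_add' := fun _ _ => rfl }

theorem coeff_residue (p : DiffOp (LaurentSeries F)) (i j : ℕ) :
    (residue p).coeff i j = (p.coeff i j).coeff 0 := rfl

theorem residue_smul (a : F) (p : DiffOp (LaurentSeries F)) :
    residue (HahnSeries.single (0 : ℤ) a • p) = a • residue p := by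
  ext i j
  rw [coeff_residue, coeff_smul, HahnSeries.coeff_single_mul, DiffOp.coeff_smul, coeff_residue,
    sub_zero]

/-- An operator with power series coefficients. -/
def IsIntegral (p : DiffOp (LaurentSeries F)) : Prop := ∀ i j, p.coeff i j ∈ powerSeries F

/-- An integral operator is a sum of integral monomials. -/
theorem IsIntegral.induction_on {P : DiffOp (LaurentSeries F) → Prop}
    {p : DiffOp (LaurentSeries F)} (hp : IsIntegral p) (h0 : P 0)
    (hadd : ∀ p q, P p → P q → P (p + q))
    (hmon : ∀ i j, ∀ a ∈ powerSeries F, P (monomial i j a)) : P p := by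
  have h : p = ∑ ij ∈ (show ℕ × ℕ →₀ LaurentSeries F from p).support,
      monomial ij.1 ij.2 (p.coeff ij.1 ij.2) :=
    (Finsupp.sum_single (M := LaurentSeries F) p).symm
  rw [h]
  exact Finset.sum_induction _ P hadd h0 fun ij _ => hmon _ _ _ (hp _ _)

theorem residue_monomial (i j : ℕ) (a : LaurentSeries F) :
    residue (monomial i j a) = monomial i j (a.coeff 0) :=
  Finsupp.mapRange_single (M := LaurentSeries F) (N := F) (hf := rfl)

variable [PartialDiffField F]

theorem residue_leftMul_x (p : DiffOp (LaurentSeries F)) :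
    residue (leftMul dx 1 0 p) = leftMul dx 1 0 (residue p) := by
  ext i j
  obtain _ | i := i
  · rw [coeff_residue, coeff_leftMul_x_zero, coeff_leftMul_x_zero, coeff_residue, coeff_dx]
  · rw [coeff_residue, coeff_leftMul_x_succ, coeff_leftMul_x_succ, coeff_residue, coeff_residue,
      HahnSeries.coeff_add, coeff_dx]

theorem residue_leftMul_y (p : DiffOp (LaurentSeries F)) :
    residue (leftMul dy 0 1 p) = leftMul dy 0 1 (residue p) := by
  ext i j
  obtain _ | j := j
  · rw [coeff_residue, coeff_leftMul_y_zero, coeff_leftMul_y_zero, coeff_residue, coeff_dy]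
  · rw [coeff_residue, coeff_leftMul_y_succ, coeff_leftMul_y_succ, coeff_residue, coeff_residue,
      HahnSeries.coeff_add, coeff_dy]

theorem dx_mem_orderGE {m : ℤ} {a : LaurentSeries F} (ha : a ∈ orderGE F m) :
    dx a ∈ orderGE F m := fun n hn => by rw [coeff_dx, ha n hn, map_zero]

theorem dy_mem_orderGE {m : ℤ} {a : LaurentSeries F} (ha : a ∈ orderGE F m) :
    dy a ∈ orderGE F m := fun n hn => by rw [coeff_dy, ha n hn, map_zero]

theorem IsIntegral.leftMul_x {p : DiffOp (LaurentSeries F)} (hp : IsIntegral p) :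
    IsIntegral (leftMul dx 1 0 p) := by
  intro i j
  obtain _ | i := i
  · rw [coeff_leftMul_x_zero]; exact dx_mem_orderGE (hp _ _)
  · rw [coeff_leftMul_x_succ]; exact Subring.add_mem _ (dx_mem_orderGE (hp _ _)) (hp _ _)

theorem IsIntegral.leftMul_y {p : DiffOp (LaurentSeries F)} (hp : IsIntegral p) :
    IsIntegral (leftMul dy 0 1 p) := by
  intro i j
  obtain _ | j := j
  · rw [coeff_leftMul_y_zero]; exact dy_mem_orderGE (hp _ _)
  · rw [coeff_leftMul_y_succ]; exact Subring.add_mem _ (dy_mem_orderGE (hp _ _)) (hp _ _)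

theorem IsIntegral.add {p q : DiffOp (LaurentSeries F)} (hp : IsIntegral p) (hq : IsIntegral q) :
    IsIntegral (p + q) := fun i j => Subring.add_mem _ (hp i j) (hq i j)

theorem IsIntegral.neg {p : DiffOp (LaurentSeries F)} (hp : IsIntegral p) : IsIntegral (-p) :=
  fun i j => by
    have h : (-p).coeff i j = -p.coeff i j := by
      rw [eq_neg_iff_add_eq_zero, ← DiffOp.coeff_add, neg_add_cancel, coeff_zero]
    rw [h]
    exact Subring.neg_mem _ (hp i j)

theorem IsIntegral.smul {a : LaurentSeries F} {p : DiffOp (LaurentSeries F)}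
    (ha : a ∈ powerSeries F) (hp : IsIntegral p) : IsIntegral (a • p) :=
  fun i j => Subring.mul_mem _ ha (hp i j)

/-- Denominators of operators can be cleared by powers of the variable. -/
theorem exists_isIntegral_smul (p : DiffOp (LaurentSeries F)) :
    ∃ k : ℤ, IsIntegral (HahnSeries.single k (1 : F) • p) := by
  induction p using DiffOp.induction_on with
  | h0 => exact ⟨0, fun i j => by simp⟩
  | hadd p q hp hq =>
    obtain ⟨k, hk⟩ := hp
    obtain ⟨l, hl⟩ := hq
    have key : ∀ (k m : ℤ) (p : DiffOp (LaurentSeries F)), k ≤ m →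
        IsIntegral (HahnSeries.single k (1 : F) • p) →
        IsIntegral (HahnSeries.single m (1 : F) • p) := by
      intro k m p hkm hp
      have := IsIntegral.smul (single_mem_powerSeries (sub_nonneg.2 hkm) (1 : F)) hp
      rwa [smul_smul, HahnSeries.single_mul_single, sub_add_cancel, one_mul] at this
    exact ⟨max k l, by
      rw [smul_add]
      exact (key _ _ _ (le_max_left _ _) hk).add (key _ _ _ (le_max_right _ _) hl)⟩
  | hmon i j a =>
    obtain ⟨m, hm⟩ := exists_mem_orderGE a
    refine ⟨-m, fun k l => ?_⟩
    rw [DiffOp.coeff_smul, coeff_monomial]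
    split_ifs
    · have := single_mul_mem_orderGE (-m) hm
      rwa [neg_add_cancel] at this
    · rw [mul_zero]; exact Subring.zero_mem _

/-- An operator with power series coefficients preserves the order filtration, and acts on leading
coefficients through its constant part. -/
theorem act_mem_orderGE {p : DiffOp (LaurentSeries F)} (hp : IsIntegral p) {m : ℤ}
    {y : LaurentSeries F} (hy : y ∈ orderGE F m) :
    act (fieldModule _) p y ∈ orderGE F m ∧
      (act (fieldModule _) p y).coeff m = act (fieldModule F) (residue p) (y.coeff m) := by
  have hpow : ∀ i j, ((fieldModule (LaurentSeries F)).δx ^ i *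
      (fieldModule (LaurentSeries F)).δy ^ j : AddMonoid.End _) y ∈ orderGE F m ∧
      (((fieldModule (LaurentSeries F)).δx ^ i *
      (fieldModule (LaurentSeries F)).δy ^ j : AddMonoid.End _) y).coeff m =
        ((fieldModule F).δx ^ i * (fieldModule F).δy ^ j : AddMonoid.End _) (y.coeff m) := by
    intro i j
    induction i with
    | zero =>
      induction j with
      | zero => exact ⟨hy, rfl⟩
      | succ j ih =>
        rw [pow_zero, one_mul] at ih ⊢
        rw [pow_zero, one_mul] at ih ⊢
        rw [pow_succ', pow_succ', end_mul_apply, end_mul_apply, ← ih.2]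
        exact ⟨dy_mem_orderGE ih.1, rfl⟩
    | succ i ih =>
      rw [pow_succ', pow_succ', mul_assoc, mul_assoc, end_mul_apply, end_mul_apply _ _ (y.coeff m),
        ← ih.2]
      exact ⟨dx_mem_orderGE ih.1, rfl⟩
  refine hp.induction_on (P := fun p => act (fieldModule _) p y ∈ orderGE F m ∧
    (act (fieldModule _) p y).coeff m = act (fieldModule F) (residue p) (y.coeff m)) ?_ ?_ ?_
  · simp only [map_zero, AddMonoidHom.zero_apply]
    exact ⟨zero_mem _, rfl⟩
  · rintro p q ⟨hp, hp'⟩ ⟨hq, hq'⟩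
    simp only [map_add, AddMonoidHom.add_apply, HahnSeries.coeff_add, hp', hq']
    exact ⟨add_mem hp hq, trivial⟩
  · intro i j a ha
    have h := mul_mem_orderGE ha (hpow i j).1
    rw [zero_add] at h
    rw [residue_monomial, act_monomial, act_monomial, smul_eq_mul, smul_eq_mul, ← (hpow i j).2]
    exact h

/-- A compatible system stays compatible when a candidate solution `Y` is subtracted from
the unknown. -/
theorem isCompatible_translate {K : Type*} [Field K] [PartialDiffField K]
    {Γ : Submodule K (DiffOp K × K)} (hΓ : IsCompatible Γ) (Y : K) :
    ∃ Γ' : Submodule K (DiffOp K × K), IsCompatible Γ' ∧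
      ∀ p v, (p, v) ∈ Γ' ↔ (p, v + act (fieldModule K) p Y) ∈ Γ := by
  let Γ' : Submodule K (DiffOp K × K) :=
    { carrier := {x | (x.1, x.2 + act (fieldModule K) x.1 Y) ∈ Γ}
      zero_mem' := by
        change ((0 : DiffOp K), (0 : K) + act (fieldModule K) 0 Y) ∈ Γ
        rw [map_zero, AddMonoidHom.zero_apply, add_zero]
        exact Γ.zero_mem
      add_mem' := by
        rintro ⟨p, v⟩ ⟨q, w⟩ hp hq
        have := Γ.add_mem hp hq
        change (p + q, v + w + act (fieldModule K) (p + q) Y) ∈ Γ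
        rw [map_add, AddMonoidHom.add_apply, add_add_add_comm]
        exact this
      smul_mem' := by
        rintro a ⟨p, v⟩ hp
        have := Γ.smul_mem a hp
        change (a • p, a • v + act (fieldModule K) (a • p) Y) ∈ Γ
        rw [act_smul, ← smul_add]
        exact this }
  refine ⟨Γ', ⟨fun p v h => ?_, fun p v h => ?_, fun v h => ?_⟩, fun p v => Iff.rfl⟩
  · change (leftMul dx 1 0 p, dx v + act (fieldModule K) (leftMul dx 1 0 p) Y) ∈ Γ
    rw [act_leftMul_x]
    have := hΓ.x_mem _ _ h
    rwa [map_add] at this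
  · change (leftMul dy 0 1 p, dy v + act (fieldModule K) (leftMul dy 0 1 p) Y) ∈ Γ
    rw [act_leftMul_y]
    have := hΓ.y_mem _ _ h
    rwa [map_add] at this
  · have h' : (0, v + act (fieldModule K) 0 Y) ∈ Γ := h
    rw [map_zero, AddMonoidHom.zero_apply, add_zero] at h'
    exact hΓ.eq_zero v h'

/-- The integral operators `p` for which the system `Γ` contains an equation `p y = v` with `v` in
a given group `V`. -/
def integralLHS (Γ : Submodule (LaurentSeries F) (DiffOp (LaurentSeries F) × LaurentSeries F))
    (V : AddSubgroup (LaurentSeries F)) : AddSubgroup (DiffOp (LaurentSeries F)) where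
  carrier := {p | IsIntegral p ∧ ∃ v ∈ V, (p, v) ∈ Γ}
  zero_mem' := ⟨fun _ _ => Subring.zero_mem _, 0, zero_mem _, Γ.zero_mem⟩
  add_mem' := by
    rintro p q ⟨hp, v, hv, hpv⟩ ⟨hq, w, hw, hqw⟩
    exact ⟨hp.add hq, v + w, add_mem hv hw, Γ.add_mem hpv hqw⟩
  neg_mem' := by
    rintro p ⟨hp, v, hv, hpv⟩
    have h := Γ.neg_mem hpv
    rw [Prod.neg_mk] at h
    exact ⟨hp.neg, -v, neg_mem hv, h⟩

theorem isStable_integralLHS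
    {Γ : Submodule (LaurentSeries F) (DiffOp (LaurentSeries F) × LaurentSeries F)}
    (hΓ : IsCompatible Γ) {V : AddSubgroup (LaurentSeries F)}
    (hV : ∀ a ∈ powerSeries F, ∀ v ∈ V, a * v ∈ V) (hVx : ∀ v ∈ V, dx v ∈ V)
    (hVy : ∀ v ∈ V, dy v ∈ V) : IsStable (powerSeries F) (integralLHS Γ V) where
  smul_mem := by
    rintro a ha p ⟨hp, v, hv, hpv⟩
    have h := Γ.smul_mem a hpv
    rw [Prod.smul_mk, smul_eq_mul] at h
    exact ⟨hp.smul ha, a * v, hV a ha v hv, h⟩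
  x_mem := by
    rintro p ⟨hp, v, hv, hpv⟩
    exact ⟨hp.leftMul_x, dx v, hVx v hv, hΓ.x_mem _ _ hpv⟩
  y_mem := by
    rintro p ⟨hp, v, hv, hpv⟩
    exact ⟨hp.leftMul_y, dy v, hVy v hv, hΓ.y_mem _ _ hpv⟩

/-- The right-hand sides of the integral equations of a system have bounded pole order: the
integral left-hand sides are generated by finitely many of them. -/
theorem exists_bound {Γ : Submodule (LaurentSeries F) (DiffOp (LaurentSeries F) × LaurentSeries F)}
    (hΓ : IsCompatible Γ) :
    ∃ m : ℤ, ∀ p v, (p, v) ∈ Γ → IsIntegral p → v ∈ orderGE F m := by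
  obtain ⟨S, hSfin, hSN, hS⟩ := exists_finite_generators (powerSeries F) (fun a => a.order.toNat)
    (fun a ha b hb h0 h => div_mem_powerSeries ha hb h0 h) (integralLHS Γ ⊤)
    (isStable_integralLHS hΓ (fun _ _ _ _ => trivial) (fun _ _ => trivial) fun _ _ => trivial)
    fun p hp => hp.1
  have hm : ∀ p ∈ S, ∃ m : ℤ, p ∈ integralLHS Γ (orderGE F m) := by
    intro p hp
    obtain ⟨hpi, v, -, hpv⟩ := hSN hp
    obtain ⟨m, hm⟩ := exists_mem_orderGE v
    exact ⟨m, hpi, v, hm, hpv⟩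
  choose! μ hμ using hm
  obtain ⟨m, hm⟩ := (hSfin.image μ).bddBelow
  refine ⟨m, fun p v hpv hp => ?_⟩
  obtain ⟨-, w, hw, hpw⟩ : p ∈ integralLHS Γ (orderGE F m) := by
    refine hS _ (isStable_integralLHS hΓ (fun a ha v hv => ?_) (fun v => dx_mem_orderGE)
      fun v => dy_mem_orderGE) (fun q hq => ?_)
      (show p ∈ integralLHS Γ ⊤ from ⟨hp, v, trivial, hpv⟩)
    · have h := (mul_mem_orderGE ha hv).1
      rwa [zero_add] at h
    · obtain ⟨hqi, w, hw, hqw⟩ := hμ q hq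
      exact ⟨hqi, w, orderGE_mono (hm (Set.mem_image_of_mem μ hq)) hw, hqw⟩
  have hvw := Γ.sub_mem hpv hpw
  rw [Prod.mk_sub_mk, sub_self] at hvw
  rwa [sub_eq_zero.1 (hΓ.eq_zero _ hvw)]

/-- The leading coefficient of a solution is found by solving the residue system over `F`. That
system is compatible since an integral operator with vanishing residue is divisible by
the variable. -/
theorem exists_leading_coeff (hF : SolvesLinearSystems F)
    {Γ : Submodule (LaurentSeries F) (DiffOp (LaurentSeries F) × LaurentSeries F)}
    (hΓ : IsCompatible Γ) {m : ℤ} (hm : ∀ p v, (p, v) ∈ Γ → IsIntegral p → v ∈ orderGE F m) :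
    ∃ y : F, ∀ p v, (p, v) ∈ Γ → IsIntegral p →
      v - act (fieldModule _) p (HahnSeries.single m y) ∈ orderGE F (m + 1) := by
  -- The equations `residue p · y = v_m`, where `v_m` is the lowest coefficient of `v` allowed.
  let Γ₀ : Submodule F (DiffOp F × F) :=
    { carrier := {x | ∃ p v, (p, v) ∈ Γ ∧ IsIntegral p ∧ x = (residue p, v.coeff m)}
      zero_mem' := ⟨0, 0, Γ.zero_mem, fun _ _ => Subring.zero_mem _, by simp; rfl⟩
      add_mem' := by
        rintro _ _ ⟨p, v, hpv, hp, rfl⟩ ⟨q, w, hqw, hq, rfl⟩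
        exact ⟨p + q, v + w, Γ.add_mem hpv hqw, hp.add hq, by simp⟩
      smul_mem' := by
        rintro a _ ⟨p, v, hpv, hp, rfl⟩
        refine ⟨_, _, Γ.smul_mem (HahnSeries.single (0 : ℤ) a) hpv,
          hp.smul (single_mem_powerSeries le_rfl a), ?_⟩
        rw [residue_smul, smul_eq_mul, HahnSeries.coeff_single_mul, sub_zero]
        rfl }
  have hΓ₀ : IsCompatible Γ₀ := by
    refine ⟨?_, ?_, ?_⟩
    · rintro _ _ ⟨p, v, hpv, hp, h⟩
      obtain ⟨rfl, rfl⟩ := Prod.mk.inj h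
      exact ⟨_, _, hΓ.x_mem _ _ hpv, hp.leftMul_x, by rw [residue_leftMul_x, coeff_dx]⟩
    · rintro _ _ ⟨p, v, hpv, hp, h⟩
      obtain ⟨rfl, rfl⟩ := Prod.mk.inj h
      exact ⟨_, _, hΓ.y_mem _ _ hpv, hp.leftMul_y, by rw [residue_leftMul_y, coeff_dy]⟩
    · rintro _ ⟨p, v, hpv, hp, h⟩
      obtain ⟨h0, rfl⟩ := Prod.mk.inj h
      have hint : IsIntegral (HahnSeries.single (-1 : ℤ) (1 : F) • p) := by
        intro i j n hn
        rw [DiffOp.coeff_smul, HahnSeries.coeff_single_mul, one_mul]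
        rcases (show n - -1 ≤ 0 by omega).eq_or_lt with h | h
        · rw [h, ← coeff_residue, ← h0, coeff_zero]
        · exact hp i j _ h
      have := hm _ _ (Γ.smul_mem (HahnSeries.single (-1 : ℤ) (1 : F)) hpv) hint (m - 1) (by omega)
      rwa [smul_eq_mul, HahnSeries.coeff_single_mul, one_mul, sub_neg_eq_add, sub_add_cancel]
        at this
  obtain ⟨y, hy⟩ := hF Γ₀ hΓ₀
  refine ⟨y, fun p v hpv hp n hn => ?_⟩
  have hs : HahnSeries.single m y ∈ orderGE F m :=
    fun k hk => HahnSeries.coeff_single_of_ne hk.ne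
  obtain ⟨h1, h2⟩ := act_mem_orderGE hp hs
  rw [HahnSeries.coeff_sub]
  rcases (Int.lt_add_one_iff.1 hn).eq_or_lt with rfl | h
  · rw [h2, HahnSeries.coeff_single_same, hy _ _ ⟨p, v, hpv, hp, rfl⟩, sub_self]
  · rw [h1 n h, hm p v hpv hp n h, sub_self]

/-- Compatible linear systems over Laurent series are solved coefficient by coefficient. -/
theorem solvesLinearSystems (hF : SolvesLinearSystems F) :
    SolvesLinearSystems (LaurentSeries F) := by
  intro Γ hΓ
  obtain ⟨m, hm⟩ := exists_bound hΓ
  have hstep : ∀ (Y : LaurentSeries F) (k : ℤ), ∃ y : F,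
      (∀ p v, (p, v) ∈ Γ → IsIntegral p → v - act (fieldModule _) p Y ∈ orderGE F k) →
      ∀ p v, (p, v) ∈ Γ → IsIntegral p →
        v - act (fieldModule _) p (Y + HahnSeries.single k y) ∈ orderGE F (k + 1) := by
    intro Y k
    by_cases h : ∀ p v, (p, v) ∈ Γ → IsIntegral p → v - act (fieldModule _) p Y ∈ orderGE F k
    · obtain ⟨Γ', hΓ', hmem⟩ := isCompatible_translate hΓ Y
      obtain ⟨y, hy⟩ := exists_leading_coeff hF hΓ' (m := k) fun p v hpv hp => by
        simpa using h p _ ((hmem p v).1 hpv) hp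
      refine ⟨y, fun _ p v hpv hp => ?_⟩
      rw [map_add, ← sub_sub]
      exact hy p _ ((hmem p _).2 (by rwa [sub_add_cancel])) hp
    · exact ⟨0, fun h' => absurd h' h⟩
  choose y hy using hstep
  -- `Y n` is the approximation with the `n` coefficients at `m, …, m + n - 1`, and `Z` the limit.
  let Y : ℕ → LaurentSeries F :=
    fun n => Nat.rec 0 (fun n Y => Y + HahnSeries.single (m + n) (y Y (m + n))) n
  have hYs : ∀ n, Y (n + 1) = Y n + HahnSeries.single (m + n) (y (Y n) (m + n)) := fun _ => rfl
  have hY : ∀ n : ℕ, ∀ p v, (p, v) ∈ Γ → IsIntegral p →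
      v - act (fieldModule _) p (Y n) ∈ orderGE F (m + n) := by
    intro n
    induction n with
    | zero =>
      intro p v hpv hp
      change v - act (fieldModule _) p 0 ∈ _
      simpa using hm p v hpv hp
    | succ n ih =>
      intro p v hpv hp
      rw [hYs, Nat.cast_succ, ← add_assoc]
      exact hy _ _ ih p v hpv hp
  let c : ℤ → F := fun k => if m ≤ k then y (Y (k - m).toNat) k else 0
  let Z : LaurentSeries F := HahnSeries.ofSuppBddBelow c ⟨m, fun k hk => by
    by_contra h
    exact hk (if_neg h)⟩
  have hYc : ∀ (n : ℕ) (k : ℤ), (Y n).coeff k = if k < m + n then c k else 0 := by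
    intro n
    induction n with
    | zero =>
      intro k
      change (0 : F) = _
      split_ifs with h
      · exact (if_neg (by simpa using h)).symm
      · rfl
    | succ n ih =>
      intro k
      rw [hYs, HahnSeries.coeff_add, ih]
      rcases lt_trichotomy k (m + n) with h | rfl | h
      · rw [if_pos h, HahnSeries.coeff_single_of_ne h.ne, add_zero, if_pos (by push_cast; omega)]
      · rw [if_neg (lt_irrefl _), HahnSeries.coeff_single_same, zero_add,
          if_pos (by push_cast; omega)]
        simp [c]
      · rw [if_neg h.not_gt, HahnSeries.coeff_single_of_ne h.ne', add_zero,
          if_neg (by push_cast; omega)]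
  have hZ : ∀ n : ℕ, Z - Y n ∈ orderGE F (m + n) := by
    intro n k hk
    rw [HahnSeries.coeff_sub, hYc, if_pos hk]
    exact sub_self (c k)
  have hsol : ∀ p v, (p, v) ∈ Γ → IsIntegral p → act (fieldModule _) p Z = v := by
    intro p v hpv hp
    have h : ∀ n : ℕ, v - act (fieldModule _) p Z ∈ orderGE F (m + n) := by
      intro n
      have := sub_mem (hY n p v hpv hp) (act_mem_orderGE hp (hZ n)).1
      rwa [map_sub, sub_sub_sub_cancel_right] at this
    refine (sub_eq_zero.1 ?_).symm
    ext k
    exact h (k - m + 1).toNat k (by omega)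
  refine ⟨Z, fun p v hpv => ?_⟩
  obtain ⟨k, hk⟩ := exists_isIntegral_smul p
  have h := hsol _ _ (Γ.smul_mem (HahnSeries.single k (1 : F)) hpv) hk
  rw [act_smul] at h
  exact mul_left_cancel₀ (HahnSeries.single_ne_zero one_ne_zero) h

end residue

end Laurent

end FDSeries

namespace FDSeries

/-! ### Base change and twists of operators -/

open PartialDiffField

namespace DiffOp

section baseChange

variable {F K : Type*} [Field F] [PartialDiffField F] [Field K] [PartialDiffField K]

/-- Operators over `F` as operators over an extension `K`. -/
noncomputable def baseChange (φ : F →+* K) : DiffOp F →+ DiffOp K :=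
  Finsupp.mapRange.addMonoidHom (M := F) (N := K) φ.toAddMonoidHom

theorem baseChange_monomial (φ : F →+* K) (i j : ℕ) (a : F) :
    baseChange φ (monomial i j a) = monomial i j (φ a) :=
  Finsupp.mapRange_single (M := F) (N := K) (hf := map_zero φ)

theorem baseChange_leftMul (φ : F →+* K) (d : Derivation ℤ F F) (d' : Derivation ℤ K K)
    (h : ∀ a, φ (d a) = d' (φ a)) (k l : ℕ) (p : DiffOp F) :
    baseChange φ (leftMul d k l p) = leftMul d' k l (baseChange φ p) := by
  induction p using induction_on with
  | h0 => simp
  | hadd p q hp hq => simp only [map_add, hp, hq]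
  | hmon i j a =>
    rw [leftMul_monomial, map_add, baseChange_monomial, baseChange_monomial, baseChange_monomial,
      leftMul_monomial, h]

/-- Maps that are equivariant and semilinear over `φ` commute with the action of operators. -/
theorem map_act_baseChange {M : Type*} [AddCommGroup M] [Module F M] {N : Type*} [AddCommGroup N]
    [Module K N] (φ : F →+* K) (S : DiffModule F M) (S' : DiffModule K N) (f : M →+ N)
    (hf : ∀ (a : F) m, f (a • m) = φ a • f m) (hx : ∀ m, f (S.δx m) = S'.δx (f m))
    (hy : ∀ m, f (S.δy m) = S'.δy (f m)) (p : DiffOp F) (m : M) :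
    f (act S p m) = act S' (baseChange φ p) (f m) := by
  have key : ∀ i j, f ((S.δx ^ i * S.δy ^ j : AddMonoid.End M) m) =
      (S'.δx ^ i * S'.δy ^ j : AddMonoid.End N) (f m) := by
    intro i j
    induction i with
    | zero =>
      rw [pow_zero, pow_zero, one_mul, one_mul]
      induction j with
      | zero => rfl
      | succ j ih => rw [pow_succ', pow_succ', end_mul_apply, end_mul_apply, hy, ih]
    | succ i ih =>
      rw [pow_succ', pow_succ', mul_assoc, mul_assoc, end_mul_apply S.δx, hx, ih]
      rfl
  induction p using induction_on with
  | h0 => simp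
  | hadd p q hp hq => simp only [map_add, AddMonoidHom.add_apply, hp, hq]
  | hmon i j a => rw [act_monomial, baseChange_monomial, act_monomial, hf, key]

end baseChange

section twist

variable {K : Type*} [Field K] [PartialDiffField K]

theorem baseChange_id (p : DiffOp K) : baseChange (RingHom.id K) p = p := by
  ext i j
  rfl

/-- Equivariant maps commute with the action of operators. -/
theorem map_act {M M' : Type*} [AddCommGroup M] [Module K M] [AddCommGroup M'] [Module K M']
    (S : DiffModule K M) (S' : DiffModule K M') (f : M →+ M')
    (hf : ∀ (a : K) m, f (a • m) = a • f m)
    (hx : ∀ m, f (S.δx m) = S'.δx (f m)) (hy : ∀ m, f (S.δy m) = S'.δy (f m))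
    (p : DiffOp K) (m : M) : f (act S p m) = act S' p (f m) := by
  rw [map_act_baseChange (RingHom.id K) S S' f hf hx hy, baseChange_id]

/-- Replacing the actions of `d_x` and `d_y` by those of `d_x + a` and `d_y + b`, where
`d_x b = d_y a`, gives another module. -/
noncomputable abbrev twistModule {M : Type*} [AddCommGroup M] [Module K M] (S : DiffModule K M)
    (a b : K) (hab : dx b = dy a) : DiffModule K M where
  δx := S.δx + Module.toAddMonoidEnd K M a
  δy := S.δy + Module.toAddMonoidEnd K M b
  leibniz_x c m := by
    change S.δx (c • m) + a • c • m = dx c • m + c • (S.δx m + a • m)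
    rw [S.leibniz_x, smul_add, smul_comm a c, add_assoc]
  leibniz_y c m := by
    change S.δy (c • m) + b • c • m = dy c • m + c • (S.δy m + b • m)
    rw [S.leibniz_y, smul_add, smul_comm b c, add_assoc]
  comm m := by
    change S.δx (S.δy m + b • m) + a • (S.δy m + b • m) =
      S.δy (S.δx m + a • m) + b • (S.δx m + a • m)
    rw [map_add, map_add, S.leibniz_x, S.leibniz_y, S.comm, hab, smul_add, smul_add,
      smul_comm a b]
    abel

/-- The substitution `d_x ↦ d_x + a`, `d_y ↦ d_y + b` in operators, where `d_x b = d_y a`. -/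
noncomputable def twist (a b : K) (hab : dx b = dy a) (p : DiffOp K) : DiffOp K :=
  act (twistModule (selfModule K) a b hab) p (monomial 0 0 1)

variable {a b : K} (hab : dx b = dy a)

theorem twist_add (p q : DiffOp K) : twist a b hab (p + q) = twist a b hab p + twist a b hab q := by
  rw [twist, map_add]; rfl

theorem twist_smul (c : K) (p : DiffOp K) : twist a b hab (c • p) = c • twist a b hab p :=
  act_smul _ _ _ _

theorem twist_leftMul_x (p : DiffOp K) :
    twist a b hab (leftMul dx 1 0 p) = leftMul dx 1 0 (twist a b hab p) + a • twist a b hab p :=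
  act_leftMul_x _ _ _

theorem twist_leftMul_y (p : DiffOp K) :
    twist a b hab (leftMul dy 0 1 p) = leftMul dy 0 1 (twist a b hab p) + b • twist a b hab p :=
  act_leftMul_y _ _ _

theorem dx_neg_eq_dy_neg (hab : dx b = dy a) : dx (-b) = dy (-a) := by
  rw [map_neg, map_neg, hab]

/-- Twists by opposite elements are inverse to each other. -/
theorem twist_neg_twist (p : DiffOp K) :
    twist (-a) (-b) (dx_neg_eq_dy_neg hab) (twist a b hab p) = p := by
  have hab' := dx_neg_eq_dy_neg hab
  have hx : ∀ q, twist (-a) (-b) hab' (leftMul dx 1 0 q + a • q) =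
      leftMul dx 1 0 (twist (-a) (-b) hab' q) := fun q => by
    rw [twist_add, twist_leftMul_x, twist_smul, neg_smul, neg_add_cancel_right]
  have hy : ∀ q, twist (-a) (-b) hab' (leftMul dy 0 1 q + b • q) =
      leftMul dy 0 1 (twist (-a) (-b) hab' q) := fun q => by
    rw [twist_add, twist_leftMul_y, twist_smul, neg_smul, neg_add_cancel_right]
  have h1 : twist (-a) (-b) hab' (monomial 0 0 1) = monomial 0 0 1 := one_act _ _
  have h := map_act (twistModule (selfModule K) a b hab) (selfModule K)
    (AddMonoidHom.mk' (twist (-a) (-b) hab') (twist_add hab')) (twist_smul hab') hx hy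
    p (monomial 0 0 1)
  rw [AddMonoidHom.mk'_apply, h1, act_one] at h
  exact h

/-- A twisted operator acts like the operator in the twisted module. -/
theorem act_twist {M : Type*} [AddCommGroup M] [Module K M] (S : DiffModule K M) (p : DiffOp K)
    (m : M) : act S (twist a b hab p) m = act (twistModule S a b hab) p m := by
  let f : DiffOp K →+ M := AddMonoidHom.mk' (fun q => act S q m) fun p q => by
    rw [map_add, AddMonoidHom.add_apply]
  have h := map_act (twistModule (selfModule K) a b hab) (twistModule S a b hab) f
    (fun c q => act_smul S c q m)
    (fun q => by
      change act S (leftMul dx 1 0 q + a • q) m = S.δx (act S q m) + a • act S q m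
      rw [map_add, AddMonoidHom.add_apply, act_leftMul_x, act_smul])
    (fun q => by
      change act S (leftMul dy 0 1 q + b • q) m = S.δy (act S q m) + b • act S q m
      rw [map_add, AddMonoidHom.add_apply, act_leftMul_y, act_smul])
    p (monomial 0 0 1)
  refine h.trans ?_
  have h1 : f (monomial 0 0 1) = m := one_act S m
  rw [h1]

/-- Let `M` be an `F[d_x, d_y]`-module isomorphic to an extension field `K` of `F` on which `d_x`
and `d_y` act by `d_x + a` and `d_y + b`. If compatible linear systems over `K` have solutions
in `K`, those over `F` have solutions in `M`. The system over `K` spanned by the given one is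
compatible because the twist carries it to an extension of scalars, for which the right-hand sides
still depend linearly on the left-hand sides. -/
theorem exists_solution_of_twisted (hK : SolvesLinearSystems K) {F M : Type*} [Field F]
    [PartialDiffField F] [AddCommGroup M] [Module F M] (S : DiffModule F M) (φ : F →+* K)
    (hφx : ∀ c, φ (dx c) = dx (φ c))
    (hφy : ∀ c, φ (dy c) = dy (φ c)) {a b : K} (hab : dx b = dy a) (Θ : M →+ K)
    (hΘ : Function.Bijective Θ) (hΘs : ∀ (c : F) m, Θ (c • m) = φ c * Θ m)
    (hΘx : ∀ m, Θ (S.δx m) = dx (Θ m) + a * Θ m) (hΘy : ∀ m, Θ (S.δy m) = dy (Θ m) + b * Θ m)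
    (Γ : Submodule F (DiffOp F × M)) (hx : ∀ p v, (p, v) ∈ Γ → (leftMul dx 1 0 p, S.δx v) ∈ Γ)
    (hy : ∀ p v, (p, v) ∈ Γ → (leftMul dy 0 1 p, S.δy v) ∈ Γ) (h0 : ∀ v, (0, v) ∈ Γ → v = 0) :
    ∃ m : M, ∀ p v, (p, v) ∈ Γ → act S p m = v := by
  obtain ⟨l, hl⟩ := exists_linearMap_of_graph Γ h0
  -- The right-hand sides depend on the left-hand sides through an `F`-linear map `l`; `Φ` is its
  -- `K`-linear extension.
  let Φ : DiffOp K →ₗ[K] K :=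
    Finsupp.linearCombination K fun ij : ℕ × ℕ => Θ (l (monomial ij.1 ij.2 1))
  have hΦ : ∀ p, Φ (baseChange φ p) = Θ (l p) := by
    intro p
    induction p using induction_on with
    | h0 => simp
    | hadd p q hp hq => simp only [map_add, hp, hq]
    | hmon i j c =>
      have h1 : (monomial i j c : DiffOp F) = c • monomial i j 1 := by
        rw [smul_monomial, mul_one]
      rw [baseChange_monomial, h1, map_smul, hΘs]
      exact Finsupp.linearCombination_single _ _ _
  let σ : DiffOp F → DiffOp K := fun p => twist a b hab (baseChange φ p)
  let g : DiffOp F × M → DiffOp K × K := fun x => (σ x.1, Θ x.2)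
  let ΓK : Submodule K (DiffOp K × K) := Submodule.span K (g '' Γ)
  have hgen : ∀ p v, (p, v) ∈ Γ → (σ p, Θ v) ∈ ΓK := fun p v h =>
    Submodule.subset_span ⟨(p, v), h, rfl⟩
  -- After the inverse twist, the right-hand sides are given by `Φ`, so `(0, v)` forces `v = 0`.
  have hΓΦ : ∀ x ∈ ΓK, Φ (twist (-a) (-b) (dx_neg_eq_dy_neg hab) x.1) = x.2 := by
    intro x hx
    induction hx using Submodule.span_induction with
    | mem x hx =>
      obtain ⟨⟨p, v⟩, hpv, rfl⟩ := hx
      change Φ (twist _ _ _ (twist _ _ _ (baseChange φ p))) = Θ v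
      rw [twist_neg_twist, hΦ, hl p v hpv]
    | zero =>
      have := twist_smul (dx_neg_eq_dy_neg hab) 0 0
      rw [zero_smul, zero_smul] at this
      rw [Prod.fst_zero, Prod.snd_zero, this, map_zero]
    | add x y _ _ hx hy => rw [Prod.fst_add, Prod.snd_add, twist_add, map_add, hx, hy]
    | smul c x _ hx => rw [Prod.smul_fst, Prod.smul_snd, twist_smul, map_smul, hx]
  have hσx : ∀ p, σ (leftMul dx 1 0 p) = leftMul dx 1 0 (σ p) + a • σ p := fun p =>
    (congrArg _ (baseChange_leftMul φ dx dx hφx 1 0 p)).trans (twist_leftMul_x hab _)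
  have hσy : ∀ p, σ (leftMul dy 0 1 p) = leftMul dy 0 1 (σ p) + b • σ p := fun p =>
    (congrArg _ (baseChange_leftMul φ dy dy hφy 0 1 p)).trans (twist_leftMul_y hab _)
  have hstab : ∀ (d : Derivation ℤ K K) (i j : ℕ),
      (∀ p v, (p, v) ∈ Γ → (leftMul d i j (σ p), d (Θ v)) ∈ ΓK) →
      ∀ x ∈ ΓK, (leftMul d i j x.1, d x.2) ∈ ΓK := by
    intro d i j hd x hx'
    induction hx' using Submodule.span_induction with
    | mem x hx' =>
      obtain ⟨⟨p, v⟩, hpv, rfl⟩ := hx'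
      exact hd p v hpv
    | zero =>
      rw [Prod.fst_zero, Prod.snd_zero, map_zero, map_zero]
      exact ΓK.zero_mem
    | add x y _ _ hx hy =>
      rw [Prod.fst_add, Prod.snd_add, map_add, map_add]
      exact ΓK.add_mem hx hy
    | smul c x hx' hx =>
      have h := ΓK.add_mem (ΓK.smul_mem (d c) hx') (ΓK.smul_mem c hx)
      have h2 : d (c • x.2) = d c • x.2 + c • d x.2 := by
        simp only [smul_eq_mul, Derivation.leibniz]
        ring
      rw [Prod.smul_fst, Prod.smul_snd, leftMul_smul, h2]
      exact h
  have hΓK : IsCompatible ΓK := by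
    refine ⟨fun p v h => ?_, fun p v h => ?_, fun v h => ?_⟩
    · refine hstab dx 1 0 (fun p v hpv => ?_) (p, v) h
      have h := ΓK.sub_mem (hgen _ _ (hx p v hpv)) (ΓK.smul_mem a (hgen _ _ hpv))
      rwa [Prod.smul_mk, Prod.mk_sub_mk, hσx, hΘx, smul_eq_mul, add_sub_cancel_right,
        add_sub_cancel_right] at h
    · refine hstab dy 0 1 (fun p v hpv => ?_) (p, v) h
      have h := ΓK.sub_mem (hgen _ _ (hy p v hpv)) (ΓK.smul_mem b (hgen _ _ hpv))
      rwa [Prod.smul_mk, Prod.mk_sub_mk, hσy, hΘy, smul_eq_mul, add_sub_cancel_right,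
        add_sub_cancel_right] at h
    · have h1 := hΓΦ _ h
      have h2 := twist_smul (dx_neg_eq_dy_neg hab) 0 0
      rw [zero_smul, zero_smul] at h2
      rw [h2, map_zero] at h1
      exact h1.symm
  obtain ⟨y, hy'⟩ := hK ΓK hΓK
  obtain ⟨m, rfl⟩ := hΘ.2 y
  refine ⟨m, fun p v hpv => hΘ.1 ?_⟩
  rw [← hy' _ _ (hgen p v hpv), act_twist]
  exact map_act_baseChange φ S (twistModule (fieldModule K) a b hab) Θ hΘs hΘx hΘy p m

end twist

end DiffOp

end FDSeries

namespace FDSeries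

/-! ### The module of fractional-derivatives series -/

open PartialDiffField

namespace FracSymbol

variable {F : Type*}

theorem exists_int_s (G : FracSymbol F) (i : Fin (G.length + 1)) :
    ∃ n : ℤ, G.s i = n / G.q := by
  obtain ⟨n, hn⟩ := G.exists_nat_s i
  refine ⟨G.q - n, ?_⟩
  have hq : (G.q : ℚ) ≠ 0 := Nat.cast_ne_zero.2 G.q_pos.ne'
  rw [hn]
  push_cast
  rw [sub_div, div_self hq]

/-- The integer `q s_i`. -/
noncomputable def num (G : FracSymbol F) (i : Fin (G.length + 1)) : ℤ := (G.exists_int_s i).choose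

theorem s_eq_num_div (G : FracSymbol F) (i : Fin (G.length + 1)) : G.s i = G.num i / G.q :=
  (G.exists_int_s i).choose_spec

variable [Field F]

/-- The Laurent series in `τ = T^{-1/q}` with the same coefficients as a fractional-derivatives
series, `G^{(r)}` being replaced by `T^r`. -/
noncomputable def toLaurent (G : FracSymbol F) : G.series →+ LaurentSeries F where
  toFun c := HahnSeries.ofSuppBddBelow (fun n : ℤ => c.1.coeff (-n / G.q)) (by
    obtain ⟨s₀, ⟨m, hm⟩, h⟩ := c.2
    have hq : (G.q : ℚ) ≠ 0 := Nat.cast_ne_zero.2 G.q_pos.ne'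
    refine ⟨-m, fun n hn => ?_⟩
    obtain ⟨i, hi⟩ := h _ hn
    have h1 : (-n : ℚ) = m - i := by
      rw [← hm]
      field_simp at hi
      linarith
    have h2 : -n = m - (i : ℤ) := by exact_mod_cast h1
    omega)
  map_zero' := by ext n; rfl
  map_add' c c' := by ext n; rfl

theorem coeff_toLaurent (G : FracSymbol F) (c : G.series) (n : ℤ) :
    (G.toLaurent c).coeff n = c.1.coeff (-n / G.q) := rfl

theorem toLaurent_bijective (G : FracSymbol F) : Function.Bijective G.toLaurent := by
  have hq : (G.q : ℚ) ≠ 0 := Nat.cast_ne_zero.2 G.q_pos.ne'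
  constructor
  · refine (injective_iff_map_eq_zero _).2 fun c hc => Subtype.ext (funext fun r => ?_)
    by_contra hr
    obtain ⟨s₀, ⟨m, hm⟩, h⟩ := c.2
    obtain ⟨i, hi⟩ := h r hr
    have h1 : r = -((i - m : ℤ) : ℚ) / G.q := by
      rw [hi]
      push_cast
      field_simp
      rw [hm]
      ring
    apply hr
    have h2 := congrArg (fun k : LaurentSeries F => k.coeff (i - m)) hc
    change c.1.coeff (-((i - m : ℤ) : ℚ) / G.q) = 0 at h2
    rw [← h1] at h2
    exact h2
  · intro k
    classical
    let c : G.Formal := fun r => if h : ∃ n : ℤ, r = -n / G.q then k.coeff h.choose else 0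
    have hc : ∀ n : ℤ, c.coeff (-n / G.q) = k.coeff n := by
      intro n
      have h : ∃ n' : ℤ, (-n / G.q : ℚ) = -n' / G.q := ⟨n, rfl⟩
      have h1 := h.choose_spec
      have h2 : n = h.choose := by
        rw [div_left_inj' hq, neg_inj] at h1
        exact_mod_cast h1
      change (if h : ∃ n' : ℤ, (-n / G.q : ℚ) = -n' / G.q then k.coeff h.choose else 0) = _
      rw [dif_pos h, ← h2]
    have hmem : c ∈ G.series := by
      refine ⟨-k.order / G.q, ⟨-k.order, by push_cast; field_simp⟩, fun r hr => ?_⟩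
      have h : ∃ n : ℤ, r = -n / G.q := by
        by_contra h
        exact hr (dif_neg h)
      obtain ⟨n, rfl⟩ := h
      rw [hc] at hr
      have h1 : k.order ≤ n := HahnSeries.order_le_of_coeff_ne_zero hr
      obtain ⟨i, hi⟩ := Int.eq_ofNat_of_zero_le (sub_nonneg.2 h1)
      refine ⟨i, ?_⟩
      have h2 : (n : ℚ) - k.order = i := by exact_mod_cast hi
      rw [← h2]
      field_simp
      ring
    refine ⟨⟨c, hmem⟩, ?_⟩
    ext n
    exact hc n

/-- The series `∑ (d f_i) T^{s_i}`, by which `d` on `V_G` differs from the coefficientwise action of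
`d` on Laurent series. -/
noncomputable def connection (G : FracSymbol F) (d : Derivation ℤ F F) : LaurentSeries F :=
  ∑ i, HahnSeries.single (-G.num i) (d (G.f i))

theorem toLaurent_smul (G : FracSymbol F) (a : F) (c : G.series) :
    G.toLaurent (a • c) = HahnSeries.C a * G.toLaurent c := by
  ext n
  rw [HahnSeries.C_mul_eq_smul]
  rfl

theorem coeff_toLaurent_deriv (G : FracSymbol F) (d : Derivation ℤ F F) (c : G.series) (n : ℤ) :
    (G.toLaurent ⟨G.deriv d c.1, G.deriv_mem d c.2⟩).coeff n =
      d ((G.toLaurent c).coeff n) + (G.connection d * G.toLaurent c).coeff n := by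
  rw [coeff_toLaurent, coeff_deriv, connection, Finset.sum_mul, HahnSeries.coeff_sum,
    ← coeff_toLaurent]
  congr 1
  refine Finset.sum_congr rfl fun i _ => ?_
  rw [HahnSeries.coeff_single_mul, coeff_toLaurent, s_eq_num_div]
  congr 2
  push_cast
  ring

variable [PartialDiffField F]

theorem dx_connection (G : FracSymbol F) :
    dx (G.connection dy) = dy (G.connection dx) := by
  have h : ∀ (m : ℤ) (a : F), dx (HahnSeries.single m a) = HahnSeries.single m (dx a) := by
    intro m a
    ext n
    rw [Laurent.coeff_dx, HahnSeries.coeff_single, HahnSeries.coeff_single]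
    split_ifs <;> simp
  have h' : ∀ (m : ℤ) (a : F), dy (HahnSeries.single m a) = HahnSeries.single m (dy a) := by
    intro m a
    ext n
    rw [Laurent.coeff_dy, HahnSeries.coeff_single, HahnSeries.coeff_single]
    split_ifs <;> simp
  rw [connection, connection, map_sum, map_sum]
  exact Finset.sum_congr rfl fun i _ => by rw [h, h', dx_dy_comm]

open DiffOp in
/-- Compatible linear systems with coefficients in `F` and right-hand sides in `V_G` have solutions
in `V_G`. -/
theorem exists_solution (hF : SolvesLinearSystems F) (G : FracSymbol F)
    (Γ : Submodule F (DiffOp F × G.series))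
    (hx : ∀ p v, (p, v) ∈ Γ → (leftMul dx 1 0 p, DiffModule.δx F v) ∈ Γ)
    (hy : ∀ p v, (p, v) ∈ Γ → (leftMul dy 0 1 p, DiffModule.δy F v) ∈ Γ)
    (h0 : ∀ v, (0, v) ∈ Γ → v = 0) : ∃ m : G.series, ∀ p v, (p, v) ∈ Γ → p • m = v := by
  refine exists_solution_of_twisted (Laurent.solvesLinearSystems hF) _ HahnSeries.C
    (fun c => ?_) (fun c => ?_) G.dx_connection G.toLaurent G.toLaurent_bijective
    G.toLaurent_smul (fun m => ?_) (fun m => ?_) Γ hx hy h0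
  · ext n
    rw [Laurent.coeff_dx, HahnSeries.C_apply, HahnSeries.C_apply, HahnSeries.coeff_single,
      HahnSeries.coeff_single]
    split_ifs <;> simp
  · ext n
    rw [Laurent.coeff_dy, HahnSeries.C_apply, HahnSeries.C_apply, HahnSeries.coeff_single,
      HahnSeries.coeff_single]
    split_ifs <;> simp
  · ext n
    exact G.coeff_toLaurent_deriv dx m n
  · ext n
    exact G.coeff_toLaurent_deriv dy m n

end FracSymbol

/-! ### Relative syzygies -/

section relativeSyzygies

open DiffOp

variable {F : Type*} [Field F] [PartialDiffField F]

/-- The equations `(∑ q_i p_i) y = ∑ q_i w_i`, for all tuples of operators `q`. -/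
noncomputable def prescribedSystem {M : Type*} [AddCommGroup M] [Module F M] [DiffModule F M]
    {t : ℕ} (p : Fin t → DiffOp F) (w : Fin t → M) : Submodule F (DiffOp F × M) where
  carrier := {x | ∃ q : Fin t → DiffOp F, x = (∑ i, q i * p i, ∑ i, q i • w i)}
  zero_mem' := ⟨0, by simp; rfl⟩
  add_mem' := by
    rintro _ _ ⟨q, rfl⟩ ⟨q', rfl⟩
    exact ⟨q + q', by simp [add_mul, add_smul, Finset.sum_add_distrib]⟩
  smul_mem' := by
    rintro a _ ⟨q, rfl⟩
    refine ⟨fun i => a • q i, ?_⟩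
    rw [Prod.smul_mk, Finset.smul_sum, Finset.smul_sum]
    exact congrArg₂ Prod.mk
      (Finset.sum_congr rfl fun i _ => (smul_mul_assoc a (q i) (p i)).symm)
      (Finset.sum_congr rfl fun i _ => (act_smul _ a (q i) (w i)).symm)

/-- Elements `w_1, …, w_t` satisfying the relative syzygies have the form `w_i = p_i v`. -/
theorem exists_smul_eq (hF : SolvesLinearSystems F) (G : FracSymbol F) (J : Ideal (DiffOp F))
    {t : ℕ} (p : Fin t → DiffOp F) (w : Fin t → G.series)
    (hw : w ∈ moduleSolutions G.series (relSyz J p)) :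
    ∃ v : G.series, ∀ q : Fin t → DiffOp F, (∑ i, q i * p i) • v = ∑ i, q i • w i := by
  obtain ⟨v, hv⟩ := G.exists_solution hF (prescribedSystem p w)
    (by
      rintro _ _ ⟨q, h⟩
      obtain ⟨rfl, rfl⟩ := Prod.mk.inj h
      refine ⟨fun i => leftMul dx 1 0 (q i), ?_⟩
      rw [map_sum, map_sum]
      exact congrArg₂ Prod.mk
        (Finset.sum_congr rfl fun i _ => (act_leftMul_x (selfModule F) (q i) (p i)).symm)
        (Finset.sum_congr rfl fun i _ => (act_leftMul_x _ (q i) (w i)).symm))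
    (by
      rintro _ _ ⟨q, h⟩
      obtain ⟨rfl, rfl⟩ := Prod.mk.inj h
      refine ⟨fun i => leftMul dy 0 1 (q i), ?_⟩
      rw [map_sum, map_sum]
      exact congrArg₂ Prod.mk
        (Finset.sum_congr rfl fun i _ => (act_leftMul_y (selfModule F) (q i) (p i)).symm)
        (Finset.sum_congr rfl fun i _ => (act_leftMul_y _ (q i) (w i)).symm))
    (by
      rintro _ ⟨q, h⟩
      obtain ⟨h1, rfl⟩ := Prod.mk.inj h
      refine hw q ?_
      change ∑ i, q i * p i ∈ J
      rw [← h1]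
      exact J.zero_mem)
  exact ⟨v, fun q => hv _ _ ⟨q, rfl⟩⟩

theorem mem_solutions_span_range {M : Type*} [AddCommGroup M] [Module F M] [DiffModule F M]
    {t : ℕ} (p : Fin t → DiffOp F) (v : M) :
    v ∈ solutions M (Ideal.span (Set.range p)) ↔ ∀ i, p i • v = 0 := by
  refine ⟨fun h i => h _ (Ideal.subset_span ⟨i, rfl⟩), fun h r hr => ?_⟩
  obtain ⟨q, rfl⟩ := (Submodule.mem_span_range_iff_exists_fun _).1 hr
  rw [Finset.sum_smul]
  exact Finset.sum_eq_zero fun i _ => by rw [smul_assoc, h, smul_zero]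

end relativeSyzygies

end FDSeries

theorem mainTheorem5 {F : Type u} [Field F] [CharZero F] [FDSeries.PartialDiffField F]
    (hF : FDSeries.IsDifferentiallyClosed F)
    (J J₁ : Ideal (FDSeries.DiffOp F)) (hJ : FDSeries.IsNonHolonomic J)
    (hJ₁ : FDSeries.IsNonHolonomic J₁) (hJJ₁ : J ≤ J₁)
    (G : FDSeries.FracSymbol F)
    (t : ℕ) (p : Fin t → FDSeries.DiffOp F) (hp : Ideal.span (Set.range p) = J₁) :
    FDSeries.solutions G.series J₁ ≤ FDSeries.solutions G.series J ∧
    ∃ e : (FDSeries.solutions G.series J ⧸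
          (FDSeries.solutions G.series J₁).submoduleOf (FDSeries.solutions G.series J))
        ≃ₗ[FDSeries.constants F]
          FDSeries.moduleSolutions G.series (FDSeries.relSyz J p),
      ∀ (v : FDSeries.solutions G.series J) (i : Fin t),
        (e (Submodule.Quotient.mk v) : Fin t → G.series) i = p i • (v : G.series) := by
  subst hp
  refine ⟨fun v hv r hr => hv r (hJJ₁ hr), ?_⟩
  let f : FDSeries.solutions G.series J →ₗ[FDSeries.constants F]
      FDSeries.moduleSolutions G.series (FDSeries.relSyz J p) :=
    { toFun := fun v => ⟨fun i => p i • (v : G.series), fun q hq => by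
        have h : (∑ i, q i * p i) • (v : G.series) = 0 := v.2 _ hq
        rw [Finset.sum_smul] at h
        rw [← h]
        exact Finset.sum_congr rfl fun i _ => (mul_smul (q i) (p i) (v : G.series)).symm⟩
      map_add' := fun v w => Subtype.ext (funext fun i => smul_add (p i) (v : G.series) w)
      map_smul' := fun c v => Subtype.ext (funext fun i =>
        FDSeries.DiffOp.smul_constants_smul c (p i) (v : G.series)) }
  have hker : LinearMap.ker f = (FDSeries.solutions G.series
      (Ideal.span (Set.range p))).submoduleOf (FDSeries.solutions G.series J) := by
    ext v
    refine Iff.trans ?_ (FDSeries.mem_solutions_span_range p (v : G.series)).symm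
    exact ⟨fun h i => congrFun (congrArg Subtype.val h) i, fun h => Subtype.ext (funext h)⟩
  -- Surjectivity is the solvability of `p_i v = w_i` in `V_G`; the relative syzygies given by the
  -- elements of `J` show that the solution is annihilated by `J`.
  have hsurj : Function.Surjective f := by
    intro w
    obtain ⟨v, hv⟩ := FDSeries.exists_smul_eq
      (FDSeries.DiffOp.solvesLinearSystems_of_isDifferentiallyClosed hF) G J p w.1 w.2
    have hvJ : v ∈ FDSeries.solutions G.series J := by
      intro r hr
      obtain ⟨q, rfl⟩ := (Submodule.mem_span_range_iff_exists_fun _).1 (hJJ₁ hr)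
      exact (hv q).trans (w.2 q hr)
    refine ⟨⟨v, hvJ⟩, Subtype.ext (funext fun i => ?_)⟩
    classical
    -- The operator `p_i` itself is the combination with coefficients `q = e_i`.
    have h := hv (Pi.single i 1)
    simp only [Pi.single_apply, ite_mul, ite_smul, one_mul, one_smul, zero_mul, zero_smul,
      Finset.sum_ite_eq', Finset.mem_univ, if_true] at h
    exact h
  exact ⟨(Submodule.quotEquivOfEq _ _ hker.symm).trans (f.quotKerEquivOfSurjective hsurj),
    fun v i => rfl⟩
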